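/- Let $SG(n)$ be the two-dimensional Sierpinski gasket graph at stage $n \ge 0$: $SG(0)$ is a triangle, and $SG(n+1)$ is obtained from three copies of $SG(n)$, each with its three outermost (corner) vertices, by arranging them as the three corner triangles of a triangle of twice the side length, so that any two copies share exactly one corner vertex (equivalently, identifying one corner of each copy with a corner of each of the other two, so that $SG(n)$ has $\frac32(3^n+1)$ vertices and $3^{n+1}$ edges; the three corners not identified are the corners of $SG(n+1)$). For a vertex $x$ of $SG(n)$ and $j \in \{1,2,3,4\}$ let \[ F_j(n,x) = \frac{\#\{T : T \text{ a spanning tree of } SG(n) \text{ in which } x \text{ has degree } j\}}{\#\{T : T \text{ a spanning tree of } SG(n)\}}, \qquad \phi_j(n) = \frac{1}{|V(SG(n))|} \sum_{x \in V(SG(n))} F_j(n,x). \] Then the limits $\phi_j = \lim_{n\to\infty} \phi_j(n)$ exist for $j = 1,2,3,4$ and are \[ \phi_1 = \frac{10957}{40464}, \qquad \phi_2 = \frac{6626035}{13636368}, \qquad \phi_3 = \frac{2943139}{13636368}, \qquad \phi_4 = \frac{124895}{4545456}. \] -/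

import Mathlib

/-- Vertices of the two-dimensional Sierpinski gasket at stage `n`. The pair `(x, y)` stands for the
point `x • u + y • v` of the plane, where `u` and `v` are two sides of a unit equilateral triangle.
Stage `0` is a triangle; stage `n + 1` consists of three translates of stage `n`, a corner triangle
of side `2 ^ n` each, any two of which share exactly one corner. -/
def sgVertices : ℕ → Finset (ℕ × ℕ)
  | 0 => {(0, 0), (1, 0), (0, 1)}
  | n + 1 =>
      sgVertices n
        ∪ (sgVertices n).image (fun p => p + (2 ^ n, 0))
        ∪ (sgVertices n).image (fun p => p + (0, 2 ^ n))

/-- Edges of the two-dimensional Sierpinski gasket at stage `n`. -/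
def sgEdges : ℕ → Finset (Sym2 (ℕ × ℕ))
  | 0 => {s((0, 0), (1, 0)), s((0, 0), (0, 1)), s((1, 0), (0, 1))}
  | n + 1 =>
      sgEdges n
        ∪ (sgEdges n).image (Sym2.map (fun p => p + (2 ^ n, 0)))
        ∪ (sgEdges n).image (Sym2.map (fun p => p + (0, 2 ^ n)))

/-- The two-dimensional Sierpinski gasket `SG(n)` as a graph on its own vertex set. -/
def SG (n : ℕ) : SimpleGraph (sgVertices n) where
  Adj x y := x ≠ y ∧ s((x : ℕ × ℕ), (y : ℕ × ℕ)) ∈ sgEdges n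
  symm := ⟨fun x y h => ⟨h.1.symm, by rw [Sym2.eq_swap]; exact h.2⟩⟩
  loopless := ⟨fun _ h => h.1 rfl⟩

/-- The set of spanning trees of a graph: the subgraphs on the same vertex set that are trees. -/
def spanningTrees {V : Type*} (G : SimpleGraph V) : Set (SimpleGraph V) :=
  {T | T ≤ G ∧ T.IsTree}

open Classical in
/-- `F_j(n, x)`: the proportion, among all spanning trees of `SG(n)`, of those in which the vertex
`x` has degree `j`. -/
noncomputable def degreeProb (j n : ℕ) (x : sgVertices n) : ℝ :=
  ({T ∈ spanningTrees (SG n) | T.degree x = j}.ncard : ℝ) / ((spanningTrees (SG n)).ncard : ℝ)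

/-- `φ_j(n)`: the average of `F_j(n, x)` over all vertices `x` of `SG(n)`. -/
noncomputable def averageDegreeProb (j n : ℕ) : ℝ :=
  (∑ x : sgVertices n, degreeProb j n x) / ((sgVertices n).card : ℝ)

/-! Cutting the gasket at the points shared by its three copies turns a spanning tree into three
spanning forests in which every tree contains a corner; conversely, whether three such forests glue
to a tree, or to a forest of the same kind, depends only on the partitions of their corners. The
numbers of forests with the various partitions keep the same ratios at every stage, up to one scale
factor. So, in a uniformly random forest, the law of the partitions in the three copies does not
depend on the stage, and given these partitions the forests in the copies are independent.

Hence the generating functions of the degrees of the corners satisfy a linear recursion, solved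
explicitly by geometric sequences. The sum of the generating functions over the other vertices
satisfies a linear recursion whose matrix has the eigenvalues `3`, `1` and `3 / 25`, and whose
inhomogeneous term is contributed by the points shared by two copies. After division by the number
of vertices, which is of order `3 ^ n`, only the eigenvalue `3` contributes to the limit. The limit
is a polynomial in the variable of the generating function, and its coefficients are the limiting
degree probabilities. -/

section Limits

open Filter Topology

lemma tendsto_coeff_of_tendsto_eval {α : Type*} {l : Filter α} {d : ℕ} {a : α → Fin d → ℝ}
    {b : Fin d → ℝ}
    (h : ∀ t : ℝ, Tendsto (fun x => ∑ j, a x j * t ^ (j : ℕ)) l (𝓝 (∑ j, b j * t ^ (j : ℕ))))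
    (j : Fin d) : Tendsto (fun x => a x j) l (𝓝 (b j)) := by
  let A := Matrix.vandermonde fun i : Fin d => (i : ℝ)
  have hA : IsUnit A.det := by
    rw [isUnit_iff_ne_zero, Matrix.det_vandermonde_ne_zero_iff]
    exact Nat.cast_injective.comp Fin.val_injective
  have hsolve (c : Fin d → ℝ) : (A⁻¹.mulVec fun i => ∑ j, c j * (i : ℝ) ^ (j : ℕ)) = c := by
    have hmul : (fun i : Fin d => ∑ j, c j * (i : ℝ) ^ (j : ℕ)) = A.mulVec c := by
      funext i
      simp only [Matrix.mulVec, dotProduct, A, Matrix.vandermonde_apply, mul_comm]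
    rw [hmul, Matrix.mulVec_mulVec, Matrix.nonsing_inv_mul A hA, Matrix.one_mulVec]
  refine Tendsto.congr (fun x => congrFun (hsolve (a x)) j) ?_
  rw [← congrFun (hsolve b) j]
  simp only [Matrix.mulVec, dotProduct]
  exact tendsto_finsetSum _ fun (i : Fin d) _ => (h i).const_mul (A⁻¹ j i)

lemma tendsto_const_mul_pow (c : ℝ) {r : ℝ} (hr : r ∈ Set.Ico 0 1) :
    Tendsto (fun n : ℕ => c * r ^ n) atTop (𝓝 0) := by
  simpa only [mul_zero] using (tendsto_pow_atTop_nhds_zero_of_lt_one hr.1 hr.2).const_mul c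

lemma tendsto_div_pow_atTop_nhds_zero {y : ℕ → ℝ} {b M : ℝ} (hb : 1 < b)
    (hy : ∀ n, |y (n + 1)| ≤ |y n| + M) : Tendsto (fun n => y n / b ^ n) atTop (𝓝 0) := by
  have hlinear (n : ℕ) : |y n| ≤ |y 0| + n * M := by
    induction n with
    | zero => simp only [Nat.cast_zero, zero_mul, add_zero, le_refl]
    | succ n ih =>
      push_cast
      linarith [hy n]
  have hzero : Tendsto (fun n : ℕ => |y 0| * (1 / b ^ n) + n / b ^ n * M) atTop (𝓝 0) := by
    have hconst := tendsto_pow_const_div_const_pow_of_one_lt 0 hb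
    have hid := tendsto_pow_const_div_const_pow_of_one_lt 1 hb
    simp only [pow_zero, pow_one] at hconst hid
    simpa only [mul_zero, zero_mul, add_zero] using (hconst.const_mul |y 0|).add (hid.mul_const M)
  refine squeeze_zero_norm (fun n => ?_) hzero
  have hpow : 0 < b ^ n := by positivity
  rw [norm_div, Real.norm_eq_abs, Real.norm_of_nonneg hpow.le, mul_one_div, div_mul_eq_mul_div,
    ← add_div]
  exact div_le_div_of_nonneg_right (hlinear n) hpow.le

end Limits

section Gluing

variable {ι V W : Type*}

/-- The union of copies of the graphs `T c` along the embeddings `f c`. -/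
def glue (f : ι → V ↪ W) (T : ι → SimpleGraph V) : SimpleGraph W :=
  ⨆ c, (T c).map (f c)

lemma glue_adj {f : ι → V ↪ W} {T : ι → SimpleGraph V} {v w : W} :
    (glue f T).Adj v w ↔ ∃ c x y, (T c).Adj x y ∧ f c x = v ∧ f c y = w := by
  simp only [glue, SimpleGraph.iSup_adj, SimpleGraph.map_adj]

lemma glue_mono {f : ι → V ↪ W} {T T' : ι → SimpleGraph V} (h : ∀ c, T c ≤ T' c) :
    glue f T ≤ glue f T' :=
  iSup_mono fun c => SimpleGraph.map_monotone (f c) (h c)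

lemma glue_comap {f : ι → V ↪ W} {G : ι → SimpleGraph V} {T : SimpleGraph W} (hT : T ≤ glue f G) :
    glue f (fun c => T.comap (f c)) = T := by
  ext v w
  refine ⟨fun hadj => ?_, fun hadj => ?_⟩
  · obtain ⟨c, x, y, hxy, rfl, rfl⟩ := glue_adj.1 hadj
    exact hxy
  · obtain ⟨c, x, y, -, rfl, rfl⟩ := glue_adj.1 (hT hadj)
    exact glue_adj.2 ⟨c, x, y, hadj, rfl, rfl⟩

/-- The embeddings `f c` place one copy of `V` at each corner of a gasket `W`: the corners of `V`
are the points `τ i`, and two copies `c ≠ d` share exactly one point, which is the corner `d` of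
copy `c` and the corner `c` of copy `d`. The corner `c` of the copy `c` becomes a corner of `W`. -/
structure IsGasketGluing (τ : ι → V) (f : ι → V ↪ W) : Prop where
  corner_injective : Function.Injective τ
  joint_comm : ∀ c d, f c (τ d) = f d (τ c)
  eq_corner : ∀ {c d x y}, f c x = f d y → c ≠ d → x = τ d
  exists_eq : ∀ w, ∃ c x, f c x = w

namespace IsGasketGluing

variable {τ : ι → V} {f : ι → V ↪ W} (h : IsGasketGluing τ f)
include h

lemma glue_adj_apply {T : ι → SimpleGraph V} {c : ι} {x y : V} :
    (glue f T).Adj (f c x) (f c y) ↔ (T c).Adj x y := by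
  refine ⟨fun hadj => ?_, fun hadj => glue_adj.2 ⟨c, x, y, hadj, rfl, rfl⟩⟩
  obtain ⟨d, x', y', hadj, hx, hy⟩ := glue_adj.1 hadj
  obtain rfl | hdc := eq_or_ne d c
  · rwa [← (f d).injective hx, ← (f d).injective hy]
  · exact absurd ((h.eq_corner hx hdc).trans (h.eq_corner hy hdc).symm) hadj.ne

lemma comap_glue (T : ι → SimpleGraph V) (c : ι) : (glue f T).comap (f c) = T c := by
  ext x y
  exact h.glue_adj_apply

lemma glue_injective : Function.Injective (glue f) := fun T T' hT => by
  funext c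
  rw [← h.comap_glue T, hT, h.comap_glue]

lemma comap_le {G : ι → SimpleGraph V} {T : SimpleGraph W} (hT : T ≤ glue f G) (c : ι) :
    T.comap (f c) ≤ G c :=
  (SimpleGraph.comap_monotone _ hT).trans_eq (h.comap_glue G c)

lemma card_edgeSet_glue [Fintype ι] [Finite V] (T : ι → SimpleGraph V) :
    Nat.card (glue f T).edgeSet = ∑ c, Nat.card (T c).edgeSet := by
  classical
  rw [← Nat.card_sigma]
  symm
  refine Nat.card_congr (Equiv.ofBijective (fun e => ⟨e.2.1.map (f e.1), ?_⟩) ⟨?_, ?_⟩)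
  · obtain ⟨c, ⟨⟨x, y⟩, hxy⟩⟩ := e
    exact h.glue_adj_apply.2 hxy
  · rintro ⟨c, ⟨⟨x, y⟩, hxy⟩⟩ ⟨d, ⟨⟨x', y'⟩, hxy'⟩⟩ heq
    obtain rfl | hcd := eq_or_ne c d
    · have he : Sym2.map (f c) s(x, y) = Sym2.map (f c) s(x', y') := congrArg Subtype.val heq
      exact congrArg (Sigma.mk c) (Subtype.ext (Sym2.map.injective (f c).injective he))
    · exfalso
      replace hxy : x ≠ y := hxy.ne
      rcases Sym2.eq_iff.1 (Subtype.ext_iff.1 heq) with ⟨hx, hy⟩ | ⟨hx, hy⟩ <;>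
        exact hxy ((h.eq_corner hx hcd).trans (h.eq_corner hy hcd).symm)
  · rintro ⟨⟨v, w⟩, hvw⟩
    obtain ⟨c, x, y, hxy, rfl, rfl⟩ := glue_adj.1 hvw
    exact ⟨⟨c, ⟨s(x, y), hxy⟩⟩, rfl⟩

lemma neighborSet_glue (T : ι → SimpleGraph V) {c : ι} {x : V} (hx : ∀ d, d ≠ c → x ≠ τ d) :
    (glue f T).neighborSet (f c x) = f c '' (T c).neighborSet x := by
  ext w
  refine ⟨fun hw => ?_, ?_⟩
  · obtain ⟨d, x', y, hxy, hx', rfl⟩ := glue_adj.1 hw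
    obtain rfl | hdc := eq_or_ne d c
    · obtain rfl := (f d).injective hx'
      exact ⟨y, hxy, rfl⟩
    · exact absurd (h.eq_corner hx'.symm hdc.symm) (hx d hdc)
  · rintro ⟨y, hy, rfl⟩
    exact h.glue_adj_apply.2 hy

lemma neighborSet_glue_junction (T : ι → SimpleGraph V) {c d : ι} (hcd : c ≠ d) :
    (glue f T).neighborSet (f c (τ d)) =
      f c '' (T c).neighborSet (τ d) ∪ f d '' (T d).neighborSet (τ c) := by
  ext w
  refine ⟨fun hw => ?_, ?_⟩
  · obtain ⟨b, x, y, hxy, hx, rfl⟩ := glue_adj.1 hw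
    obtain rfl | hbc := eq_or_ne b c
    · obtain rfl := (f b).injective hx
      exact Or.inl ⟨y, hxy, rfl⟩
    · obtain rfl := h.corner_injective (h.eq_corner hx.symm hbc.symm)
      obtain rfl := h.eq_corner hx hbc
      exact Or.inr ⟨y, hxy, rfl⟩
  · rintro (⟨y, hy, rfl⟩ | ⟨y, hy, rfl⟩)
    · exact h.glue_adj_apply.2 hy
    · rw [h.joint_comm]
      exact h.glue_adj_apply.2 hy

lemma ncard_neighborSet_glue (T : ι → SimpleGraph V) {c : ι} {x : V}
    (hx : ∀ d, d ≠ c → x ≠ τ d) :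
    ((glue f T).neighborSet (f c x)).ncard = ((T c).neighborSet x).ncard := by
  rw [h.neighborSet_glue T hx, Set.ncard_image_of_injective _ (f c).injective]

lemma ncard_neighborSet_glue_junction [Finite V] (T : ι → SimpleGraph V) {c d : ι} (hcd : c ≠ d) :
    ((glue f T).neighborSet (f c (τ d))).ncard =
      ((T c).neighborSet (τ d)).ncard + ((T d).neighborSet (τ c)).ncard := by
  rw [h.neighborSet_glue_junction T hcd, Set.ncard_union_eq,
    Set.ncard_image_of_injective _ (f c).injective, Set.ncard_image_of_injective _ (f d).injective]
  · rw [Set.disjoint_left]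
    rintro _ ⟨x, hx, rfl⟩ ⟨y, -, hxy⟩
    exact (T c).ne_of_adj hx (h.eq_corner hxy.symm hcd).symm

end IsGasketGluing

end Gluing

section Patterns

variable {ι V W : Type*}

/-- The partition of the corners `τ i` into the connected components of `G`. -/
def cornerRel (τ : ι → V) (G : SimpleGraph V) : Setoid ι :=
  G.reachableSetoid.comap τ

/-- Every vertex is connected to a corner. -/
def ReachesCorners (τ : ι → V) (G : SimpleGraph V) : Prop :=
  ∀ x, ∃ i, G.Reachable (τ i) x

/-- If the corners of copy `c` are partitioned by `r c`, this is the resulting partition of the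
points shared by copies. The point shared by the copies `c ≠ d` is `s(c, d)`, and the corner of the
glued gasket lying in copy `c` is `s(c, c)`. -/
def jointRel (r : ι → Setoid ι) : Setoid (Sym2 ι) :=
  Relation.EqvGen.setoid fun e e' => ∃ c i j, r c i j ∧ s(c, i) = e ∧ s(c, j) = e'

lemma jointRel_of_rel {r : ι → Setoid ι} {c i j : ι} (hij : r c i j) :
    jointRel r s(c, i) s(c, j) :=
  Relation.EqvGen.rel _ _ ⟨c, i, j, hij, rfl, rfl⟩

lemma card_le_card_edgeSet_add_card {ρ : Type*} [Finite V] [Finite ρ] {G : SimpleGraph V}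
    (g : ρ → V) (hg : ∀ x, ∃ i, G.Reachable (g i) x) :
    Nat.card V ≤ Nat.card G.edgeSet + Nat.card ρ := by
  obtain hρ | ⟨⟨i₀⟩⟩ := isEmpty_or_nonempty ρ
  · have : IsEmpty V := ⟨fun x => (hg x).elim fun i _ => hρ.elim i⟩
    simp only [Nat.card_of_isEmpty, Nat.zero_le]
  let star : Set (Sym2 V) := (fun i => s(g i₀, g i)) '' {i₀}ᶜ
  let H := G ⊔ SimpleGraph.fromEdgeSet star
  have hroot (i : ρ) : H.Reachable (g i₀) (g i) := by
    obtain hi | hi := eq_or_ne (g i₀) (g i)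
    · rw [hi]
    · refine SimpleGraph.Adj.reachable (Or.inr ((SimpleGraph.fromEdgeSet_adj _).2 ⟨?_, hi⟩))
      exact ⟨i, fun h => hi (congrArg g h.symm), rfl⟩
  have hH : H.Connected := by
    refine (SimpleGraph.connected_iff_exists_forall_reachable H).2 ⟨g i₀, fun x => ?_⟩
    obtain ⟨i, hi⟩ := hg x
    exact (hroot i).trans (hi.mono le_sup_left)
  have hedges : Nat.card H.edgeSet ≤ Nat.card G.edgeSet + Nat.card star := by
    simp only [Nat.card_coe_set_eq]
    refine (Set.ncard_le_ncard ?_).trans (Set.ncard_union_le _ _)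
    rw [SimpleGraph.edgeSet_sup, SimpleGraph.edgeSet_fromEdgeSet]
    exact Set.union_subset_union_right _ Set.sdiff_subset
  have hstar : Nat.card star + 1 ≤ Nat.card ρ := by
    rw [Nat.card_coe_set_eq, ← Set.ncard_add_ncard_compl {i₀}, Set.ncard_singleton, add_comm]
    exact Nat.add_le_add_left Set.ncard_image_le 1
  linarith [hH.card_vert_le_card_edgeSet_add_one]

lemma ReachesCorners.card_le [Finite ι] [Finite V] {τ : ι → V} {T : SimpleGraph V}
    (hT : ReachesCorners τ T) :
    Nat.card V ≤ Nat.card T.edgeSet + Nat.card (Quotient (cornerRel τ T)) := by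
  refine card_le_card_edgeSet_add_card (fun q => τ q.out) fun x => ?_
  obtain ⟨i, hi⟩ := hT x
  exact ⟨⟦i⟧, (Quotient.mk_out (s := cornerRel τ T) i).trans hi⟩

namespace IsGasketGluing

variable {τ : ι → V} {f : ι → V ↪ W} (h : IsGasketGluing τ f)
include h

/-- The point of the glued gasket shared by the copies `c` and `d`, or its corner if `c = d`. -/
def joint : Sym2 ι → W :=
  Sym2.lift ⟨fun c d => f c (τ d), h.joint_comm⟩

lemma exists_jointRel_of_reachable {T : ι → SimpleGraph V} {e : Sym2 ι} {w : W}
    (hw : (glue f T).Reachable (h.joint e) w) :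
    ∀ c x, f c x = w →
      ∃ i, jointRel (fun c => cornerRel τ (T c)) e s(c, i) ∧ (T c).Reachable (τ i) x := by
  rw [SimpleGraph.reachable_iff_reflTransGen] at hw
  induction hw with
  | refl =>
    intro c x hx
    induction e with | _ a b
    obtain rfl | hca := eq_or_ne c a
    · obtain rfl := (f c).injective hx
      exact ⟨b, Setoid.refl' _ _, .rfl⟩
    · obtain rfl := h.eq_corner hx hca
      obtain rfl := h.corner_injective (h.eq_corner hx.symm hca.symm)
      exact ⟨a, Sym2.eq_swap ▸ Setoid.refl' _ _, .rfl⟩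
  | tail _ hadj ih =>
    intro c x hx
    obtain ⟨d, y, y', hyy', hy, rfl⟩ := glue_adj.1 hadj
    obtain ⟨i, hei, hi⟩ := ih d y hy
    obtain rfl | hcd := eq_or_ne c d
    · obtain rfl := (f c).injective hx
      exact ⟨i, hei, hi.trans hyy'.reachable⟩
    · obtain rfl := h.eq_corner hx hcd
      obtain rfl := h.eq_corner hx.symm hcd.symm
      refine ⟨d, Setoid.trans' _ hei ?_, .rfl⟩
      rw [Sym2.eq_swap (a := c)]
      exact jointRel_of_rel (hi.trans hyy'.reachable)

lemma reachable_of_jointRel {T : ι → SimpleGraph V} {e e' : Sym2 ι}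
    (he : jointRel (fun c => cornerRel τ (T c)) e e') :
    (glue f T).Reachable (h.joint e) (h.joint e') := by
  induction he with
  | rel _ _ he =>
    obtain ⟨c, i, j, hij, rfl, rfl⟩ := he
    exact SimpleGraph.Reachable.map ⟨f c, h.glue_adj_apply.2⟩ hij
  | refl => rfl
  | symm _ _ _ ih => exact ih.symm
  | trans _ _ _ _ _ ih ih' => exact ih.trans ih'

lemma reachable_joint_iff {T : ι → SimpleGraph V} {e e' : Sym2 ι} :
    (glue f T).Reachable (h.joint e) (h.joint e') ↔
      jointRel (fun c => cornerRel τ (T c)) e e' := by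
  refine ⟨fun he => ?_, h.reachable_of_jointRel⟩
  induction e' with | _ a b
  obtain ⟨i, hei, hi⟩ := h.exists_jointRel_of_reachable he a (τ b) rfl
  exact Setoid.trans' _ hei (jointRel_of_rel hi)

lemma cornerRel_glue (T : ι → SimpleGraph V) :
    cornerRel (fun c => f c (τ c)) (glue f T) =
      (jointRel fun c => cornerRel τ (T c)).comap Sym2.diag :=
  Setoid.ext fun i j => h.reachable_joint_iff (e := s(i, i)) (e' := s(j, j))

lemma reachesCorners_glue_iff {T : ι → SimpleGraph V} :
    ReachesCorners (fun c => f c (τ c)) (glue f T) ↔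
      (∀ c, ReachesCorners τ (T c)) ∧
        ∀ e, ∃ i, jointRel (fun c => cornerRel τ (T c)) s(i, i) e := by
  refine ⟨fun hT => ⟨fun c x => ?_, fun e => ?_⟩, fun ⟨hT, hjoint⟩ w => ?_⟩
  · obtain ⟨i, hi⟩ := hT (f c x)
    obtain ⟨j, -, hj⟩ := h.exists_jointRel_of_reachable (e := s(i, i)) hi c x rfl
    exact ⟨j, hj⟩
  · obtain ⟨i, hi⟩ := hT (h.joint e)
    exact ⟨i, h.reachable_joint_iff.1 hi⟩
  · obtain ⟨c, x, rfl⟩ := h.exists_eq w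
    obtain ⟨j, hj⟩ := hT c x
    obtain ⟨i, hi⟩ := hjoint s(c, j)
    have hcopy : (glue f T).Reachable (f c (τ j)) (f c x) :=
      SimpleGraph.Reachable.map ⟨f c, h.glue_adj_apply.2⟩ hj
    exact ⟨i, (h.reachable_of_jointRel hi).trans hcopy⟩

end IsGasketGluing

end Patterns

section Interior

variable {ι V W : Type*}

open Classical in
/-- The vertices other than the corners `τ i`. -/
noncomputable def interiorVertices [Fintype V] (τ : ι → V) : Finset V :=
  {x | ∀ i, x ≠ τ i}

lemma mem_interiorVertices [Fintype V] {τ : ι → V} {x : V} :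
    x ∈ interiorVertices τ ↔ ∀ i, x ≠ τ i := by
  simp only [interiorVertices, Finset.mem_filter_univ]

lemma sum_eq_sum_corner_add_sum_interior [Fintype ι] [Fintype V] {M : Type*} [AddCommMonoid M]
    {τ : ι → V} (hτ : Function.Injective τ) (g : V → M) :
    ∑ x, g x = ∑ i, g (τ i) + ∑ x ∈ interiorVertices τ, g x := by
  classical
  have hcompl : (Finset.univ.image τ)ᶜ = interiorVertices τ := by
    ext x
    simp only [Finset.mem_compl, Finset.mem_image, Finset.mem_univ, true_and, not_exists,
      mem_interiorVertices, ne_comm (a := x), ne_eq]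
  rw [← Finset.sum_add_sum_compl (Finset.univ.image τ), Finset.sum_image hτ.injOn, hcompl]

namespace IsGasketGluing

variable {τ : Fin 3 → V} {f : Fin 3 → V ↪ W} (h : IsGasketGluing τ f)
include h

lemma ne_joint {c : Fin 3} {x : V} (hx : ∀ i, x ≠ τ i) (e : Sym2 (Fin 3)) : f c x ≠ h.joint e := by
  induction e with | _ a b
  intro heq
  obtain rfl | hca := eq_or_ne c a
  · exact hx b ((f c).injective heq)
  · exact hx a (h.eq_corner heq hca)

lemma joint_injective : Function.Injective h.joint := by
  intro e e' heq
  induction e with | _ a b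
  induction e' with | _ c d
  obtain rfl | hac := eq_or_ne a c
  · obtain rfl := h.corner_injective ((f a).injective heq)
    rfl
  · have hbc : b = c := h.corner_injective (h.eq_corner heq hac)
    have hda : d = a := h.corner_injective (h.eq_corner heq.symm hac.symm)
    rw [hbc, hda, Sym2.eq_swap]

lemma sum_interiorVertices [Fintype V] [Fintype W] {M : Type*} [AddCommMonoid M] (g : W → M) :
    ∑ w ∈ interiorVertices (fun c => f c (τ c)), g w =
      ∑ c, ∑ x ∈ interiorVertices τ, g (f c x) + ∑ k, g (f (k + 1) (τ (k + 2))) := by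
  let point : (_ : Fin 3) × V ⊕ Fin 3 → W :=
    Sum.elim (fun p => f p.1 p.2) fun k => h.joint s(k + 1, k + 2)
  rw [Finset.sum_sigma']
  refine Eq.trans (Eq.symm ?_) (Finset.sum_disjSum _ _ fun p => g (point p))
  refine Finset.sum_nbij point ?_ ?_ ?_ fun _ _ => rfl
  · rintro (⟨c, x⟩ | k) hp <;> refine mem_interiorVertices.2 fun i => ?_
    · simp only [Finset.inl_mem_disjSum, Finset.mem_sigma, mem_interiorVertices] at hp
      exact h.ne_joint hp.2 s(i, i)
    · have hdiag : ∀ k i : Fin 3, s(k + 1, k + 2) ≠ s(i, i) := by decide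
      exact h.joint_injective.ne (hdiag k i)
  · rintro (⟨c, x⟩ | k) hp (⟨d, y⟩ | l) hq heq <;>
      simp only [Finset.mem_coe, Finset.inl_mem_disjSum, Finset.mem_sigma,
        mem_interiorVertices] at hp hq
    · obtain rfl | hcd := eq_or_ne c d
      · obtain rfl := (f c).injective heq
        rfl
      · exact absurd (h.eq_corner heq hcd) (hp.2 d)
    · exact absurd heq (h.ne_joint hp.2 _)
    · exact absurd heq.symm (h.ne_joint hq.2 _)
    · have hpairs : ∀ k l : Fin 3, s(k + 1, k + 2) = s(l + 1, l + 2) → k = l := by decide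
      exact congrArg Sum.inr (hpairs k l (h.joint_injective heq))
  · intro w hw
    obtain ⟨c, x, rfl⟩ := h.exists_eq w
    by_cases hx : ∀ i, x ≠ τ i
    · refine ⟨Sum.inl ⟨c, x⟩, ?_, rfl⟩
      simpa only [Finset.mem_coe, Finset.inl_mem_disjSum, Finset.mem_sigma, Finset.mem_univ,
        true_and, mem_interiorVertices] using hx
    · push Not at hx
      obtain ⟨d, rfl⟩ := hx
      have hcd : c ≠ d := fun hcd => mem_interiorVertices.1 hw c (by rw [hcd])
      have hpairs : ∀ c d : Fin 3, c ≠ d → ∃ k : Fin 3, s(k + 1, k + 2) = s(c, d) := by decide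
      obtain ⟨k, hk⟩ := hpairs c d hcd
      exact ⟨Sum.inr k, Finset.inr_mem_disjSum.2 (Finset.mem_univ k), congrArg h.joint hk⟩

lemma corner_injective_glue : Function.Injective fun c => f c (τ c) := fun i j hij => by
  have hdiag : ∀ i j : Fin 3, s(i, i) = s(j, j) → i = j := by decide
  exact hdiag i j (h.joint_injective hij)

lemma card_add_three [Finite V] [Finite W] : Nat.card W + 3 = 3 * Nat.card V := by
  have := Fintype.ofFinite V
  have := Fintype.ofFinite W
  have hV := sum_eq_sum_corner_add_sum_interior h.corner_injective fun _ => 1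
  have hW := sum_eq_sum_corner_add_sum_interior h.corner_injective_glue fun _ => 1
  have hinterior := h.sum_interiorVertices fun _ => 1
  simp only [Finset.sum_const, smul_eq_mul, mul_one, Finset.card_univ, Fintype.card_fin]
    at hV hW hinterior
  simp only [Nat.card_eq_fintype_card]
  lia

end IsGasketGluing

end Interior

/-- The partitions of the three corners into the trees of a corner forest: one block, the corner
`i` alone, or three blocks. -/
inductive CornerPattern
  | joined
  | isolated (i : Fin 3)
  | separated
deriving DecidableEq, Fintype

/-- The position of a corner in a `CornerPattern`: in the only block, in a block with exactly one
other corner, alone while the other two are together, or alone like the other two. -/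
inductive CornerRole
  | joined
  | paired
  | isolated
  | separated
deriving DecidableEq

instance : Fintype CornerRole where
  elems := {.joined, .paired, .isolated, .separated}
  complete ρ := by cases ρ <;> decide

namespace CornerPattern

/-- The equivalence relation on the corners given by a pattern, in computable form. -/
def rel : CornerPattern → Fin 3 → Fin 3 → Bool
  | joined, _, _ => true
  | isolated i, j, k => j = k || (j ≠ i && k ≠ i)
  | separated, j, k => j = k

/-- The equivalence relation on the corners given by a pattern. -/
def toSetoid (π : CornerPattern) : Setoid (Fin 3) where
  r i j := π.rel i j
  iseqv :=
    { refl := by decide +revert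
      symm := by decide +revert
      trans := by decide +revert }

/-- The number of blocks, that is, of trees in a corner forest with this pattern. -/
def blocks : CornerPattern → ℕ
  | joined => 1
  | isolated _ => 2
  | separated => 3

/-- The relative number of corner forests with this pattern. The actual number is obtained from it
through multiplication by `J * r ^ (blocks - 1)`, where `J` and `r` depend only on the graph. -/
def weight : CornerPattern → ℕ
  | joined => 1
  | isolated _ => 1
  | separated => 3

/-- The role of the corner `i` in the pattern. -/
def role (i : Fin 3) : CornerPattern → CornerRole
  | joined => .joined
  | isolated j => if i = j then .isolated else .paired
  | separated => .separated

lemma toSetoid_injective : Function.Injective toSetoid := fun π π' hπ => by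
  have hrel : ∀ i j, π.rel i j ↔ π'.rel i j := fun i j => Setoid.ext_iff.1 hπ i j
  clear hπ
  decide +revert

lemma exists_toSetoid_eq (r : Setoid (Fin 3)) : ∃ π : CornerPattern, π.toSetoid = r := by
  classical
  have hbool : ∀ b : Fin 3 → Fin 3 → Bool, (∀ i, b i i) → (∀ i j, b i j → b j i) →
      (∀ i j k, b i j → b j k → b i k) → ∃ π : CornerPattern, ∀ i j, π.rel i j = b i j := by
    decide +kernel
  obtain ⟨π, hπ⟩ := hbool (fun i j => decide (r i j))
    (fun i => decide_eq_true (r.refl' i))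
    (fun i j hij => decide_eq_true (r.symm' (of_decide_eq_true hij)))
    (fun i j k hij hjk =>
      decide_eq_true (r.trans' (of_decide_eq_true hij) (of_decide_eq_true hjk)))
  refine ⟨π, Setoid.ext fun i j => ?_⟩
  change π.rel i j = true ↔ r i j
  rw [hπ, decide_eq_true_iff]

instance (π : CornerPattern) : DecidableRel π.toSetoid :=
  fun i j => inferInstanceAs (Decidable (π.rel i j = true))

lemma card_quotient_toSetoid (π : CornerPattern) :
    Nat.card (Quotient π.toSetoid) = π.blocks := by
  rw [Nat.card_eq_fintype_card]
  decide +revert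

end CornerPattern

/-- The copies of a gasket carrying forests with the corner patterns `π c` glue to a forest with
corner pattern `q`. The last condition says that no cycle is created, since the copies have three
points too many. -/
structure GluesTo (π : Fin 3 → CornerPattern) (q : CornerPattern) : Prop where
  comap_jointRel : (jointRel fun c => (π c).toSetoid).comap Sym2.diag = q.toSetoid
  reaches : ∀ e, ∃ i, jointRel (fun c => (π c).toSetoid) s(i, i) e
  sum_blocks : ∑ c, (π c).blocks = 3 + q.blocks

/-- Whether the corner `i` of copy `c` is connected to the corner `k` of copy `d` through exactly
`m` blocks of the partitions `π`, a decidable form of `jointRel`. -/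
def connects (π : Fin 3 → CornerPattern) : ℕ → Fin 3 → Fin 3 → Fin 3 → Fin 3 → Bool
  | 0, c, i, d, k => (c == d && i == k) || (c == k && i == d)
  | m + 1, c, i, d, k => [0, 1, 2].any fun j => (π c).rel i j && connects π m j c d k

lemma connects_comm (π : Fin 3 → CornerPattern) (m : ℕ) (c i d k : Fin 3) :
    connects π m c i d k = connects π m c i k d := by
  induction m generalizing c i with
  | zero => exact Bool.or_comm _ _
  | succ m ih => simp only [connects, ih]

lemma jointRel_of_connects {π : Fin 3 → CornerPattern} {m : ℕ} {c i d k : Fin 3}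
    (hm : connects π m c i d k) : jointRel (fun c => (π c).toSetoid) s(c, i) s(d, k) := by
  induction m generalizing c i with
  | zero =>
    have heq : s(c, i) = s(d, k) := by simpa [connects] using hm
    exact heq ▸ Setoid.refl' _ _
  | succ m ih =>
    obtain ⟨j, hij, hj⟩ : ∃ j, (π c).rel i j ∧ connects π m j c d k := by
      simpa [connects, Fin.exists_fin_succ] using hm
    exact Setoid.trans' _ (jointRel_of_rel hij) (Sym2.eq_swap ▸ ih hj)

lemma connects_of_rel : ∀ (π : Fin 3 → CornerPattern) (i c j k : Fin 3), (π c).rel j k →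
    connects π 3 i i c j → connects π 3 i i c k := by
  decide +kernel

lemma jointRel_diag_iff {π : Fin 3 → CornerPattern} {i d k : Fin 3} :
    jointRel (fun c => (π c).toSetoid) s(i, i) s(d, k) ↔ connects π 3 i i d k := by
  refine ⟨fun hrel => ?_, jointRel_of_connects⟩
  let reached : Sym2 (Fin 3) → Bool := Sym2.lift ⟨connects π 3 i i, connects_comm π 3 i i⟩
  have hreached {e e' : Sym2 (Fin 3)} (he : jointRel (fun c => (π c).toSetoid) e e') :
      reached e ↔ reached e' := by
    induction he with
    | rel e e' hee' =>
      obtain ⟨c, j, k, hjk, rfl, rfl⟩ := hee'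
      exact ⟨connects_of_rel π i c j k hjk, connects_of_rel π i c k j ((π c).toSetoid.symm' hjk)⟩
    | refl => rfl
    | symm _ _ _ ih => exact ih.symm
    | trans _ _ _ _ _ ih ih' => exact ih.trans ih'
  have hstart : ∀ (π : Fin 3 → CornerPattern) (i : Fin 3), connects π 3 i i i i := by
    decide +kernel
  exact (hreached hrel).1 (hstart π i)

lemma gluesTo_iff {π : Fin 3 → CornerPattern} {q : CornerPattern} :
    GluesTo π q ↔ ∑ c, (π c).blocks = 3 + q.blocks ∧
      (∀ i j, q.rel i j = connects π 3 i i j j) ∧ ∀ d k, ∃ i, connects π 3 i i d k := by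
  have hcomap : (jointRel fun c => (π c).toSetoid).comap Sym2.diag = q.toSetoid ↔
      ∀ i j, q.rel i j = connects π 3 i i j j := by
    refine Setoid.ext_iff.trans (forall₂_congr fun i j => ?_)
    rw [Bool.eq_iff_iff, ← jointRel_diag_iff]
    exact Iff.comm
  have hreaches : (∀ e, ∃ i, jointRel (fun c => (π c).toSetoid) s(i, i) e) ↔
      ∀ d k, ∃ i, connects π 3 i i d k := by
    simp only [Sym2.forall, jointRel_diag_iff]
  rw [← hcomap, ← hreaches]
  exact ⟨fun h => ⟨h.3, h.1, h.2⟩, fun h => ⟨h.2.1, h.2.2, h.1⟩⟩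

instance (π : Fin 3 → CornerPattern) (q : CornerPattern) : Decidable (GluesTo π q) :=
  decidable_of_iff' _ gluesTo_iff

lemma sum_blocks_le {π : Fin 3 → CornerPattern} {q : CornerPattern}
    (hcomap : (jointRel fun c => (π c).toSetoid).comap Sym2.diag = q.toSetoid)
    (hreaches : ∀ e, ∃ i, jointRel (fun c => (π c).toSetoid) s(i, i) e) :
    ∑ c, (π c).blocks ≤ 3 + q.blocks := by
  have hbound : ∀ (π : Fin 3 → CornerPattern) (q : CornerPattern),
      (∀ d k, ∃ i, connects π 3 i i d k) → (∀ i j, q.rel i j = connects π 3 i i j j) →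
        ∑ c, (π c).blocks ≤ 3 + q.blocks := by
    decide +kernel
  refine hbound π q (fun d k => ?_) fun i j => ?_
  · exact (hreaches s(d, k)).imp fun i => jointRel_diag_iff.1
  · rw [Bool.eq_iff_iff, ← jointRel_diag_iff]
    exact (Setoid.ext_iff.1 hcomap i j).symm

/-- A spanning forest each of whose trees contains a corner, and which connects the corners `τ i`
according to `π`. Acyclicity is encoded by the number of edges, which is the number of vertices
minus the number of trees. -/
structure IsCornerForest {V : Type*} (τ : Fin 3 → V) (π : CornerPattern) (T : SimpleGraph V) :
    Prop where
  reaches : ReachesCorners τ T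
  pattern : cornerRel τ T = π.toSetoid
  card_edgeSet : Nat.card T.edgeSet + π.blocks = Nat.card V

lemma isCornerForest_joined_iff {V : Type*} [Finite V] {τ : Fin 3 → V} {T : SimpleGraph V} :
    IsCornerForest τ .joined T ↔ T.IsTree := by
  rw [SimpleGraph.isTree_iff_connected_and_card]
  refine ⟨fun hT => ⟨?_, hT.card_edgeSet⟩, fun hT => ⟨fun x => ⟨0, hT.1 _ _⟩, ?_, hT.2⟩⟩
  · refine (SimpleGraph.connected_iff_exists_forall_reachable T).2 ⟨τ 0, fun x => ?_⟩
    obtain ⟨i, hi⟩ := hT.reaches x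
    exact ((Setoid.ext_iff.1 hT.pattern 0 i).2 rfl).trans hi
  · exact Setoid.ext fun i j => ⟨fun _ => rfl, fun _ => hT.1 _ _⟩

lemma IsCornerForest.pattern_unique {V : Type*} {τ : Fin 3 → V} {π π' : CornerPattern}
    {T : SimpleGraph V} (hT : IsCornerForest τ π T) (hT' : IsCornerForest τ π' T) : π = π' :=
  CornerPattern.toSetoid_injective (hT.pattern.symm.trans hT'.pattern)

section

variable {V W : Type*} [Finite V] [Finite W] {τ : Fin 3 → V} {f : Fin 3 → V ↪ W}
  (h : IsGasketGluing τ f) {T : Fin 3 → SimpleGraph V} {q : CornerPattern}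
include h

namespace IsGasketGluing

lemma isCornerForest_glue {π : Fin 3 → CornerPattern} (hT : ∀ c, IsCornerForest τ (π c) (T c))
    (hπ : GluesTo π q) : IsCornerForest (fun c => f c (τ c)) q (glue f T) := by
  have hrel : (fun c => cornerRel τ (T c)) = fun c => (π c).toSetoid :=
    funext fun c => (hT c).pattern
  refine ⟨h.reachesCorners_glue_iff.2 ⟨fun c => (hT c).reaches, hrel ▸ hπ.reaches⟩,
    (h.cornerRel_glue T).trans (hrel ▸ hπ.comap_jointRel), ?_⟩
  have hcard : ∑ c, (Nat.card (T c).edgeSet + (π c).blocks) = ∑ _c : Fin 3, Nat.card V :=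
    Finset.sum_congr rfl fun c _ => (hT c).card_edgeSet
  rw [Finset.sum_add_distrib, hπ.sum_blocks, Finset.sum_const, Finset.card_fin, smul_eq_mul,
    ← h.card_add_three] at hcard
  rw [h.card_edgeSet_glue]
  lia

lemma exists_of_isCornerForest_glue (hT : IsCornerForest (fun c => f c (τ c)) q (glue f T)) :
    ∃ π, GluesTo π q ∧ ∀ c, IsCornerForest τ (π c) (T c) := by
  choose π hπ using fun c => CornerPattern.exists_toSetoid_eq (cornerRel τ (T c))
  obtain ⟨hreach, hjoint⟩ := h.reachesCorners_glue_iff.1 hT.reaches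
  have hcomap := (h.cornerRel_glue T).symm.trans hT.pattern
  have hrel : (fun c => cornerRel τ (T c)) = fun c => (π c).toSetoid :=
    funext fun c => (hπ c).symm
  rw [hrel] at hjoint hcomap
  have hblocks := sum_blocks_le hcomap hjoint
  have hcopy (c : Fin 3) : Nat.card V ≤ Nat.card (T c).edgeSet + (π c).blocks := by
    rw [← (π c).card_quotient_toSetoid, hπ]
    exact (hreach c).card_le
  have htotal := hT.card_edgeSet
  rw [h.card_edgeSet_glue] at htotal
  have hcard := h.card_add_three
  simp only [Fin.sum_univ_three] at htotal hblocks
  have hcopies := And.intro (hcopy 0) (And.intro (hcopy 1) (hcopy 2))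
  refine ⟨π, ⟨hcomap, hjoint, ?_⟩, fun c => ⟨hreach c, (hπ c).symm, ?_⟩⟩
  · rw [Fin.sum_univ_three]
    lia
  · fin_cases c <;> simp only [Fin.zero_eta, Fin.mk_one, Fin.reduceFinMk] <;> lia

end IsGasketGluing

end

section ForestSums

open Finset

/-- The corner forests of `G` with corner pattern `π`. -/
noncomputable def cornerForests {V : Type*} [Finite V] (G : SimpleGraph V) (τ : Fin 3 → V)
    (π : CornerPattern) : Finset (SimpleGraph V) :=
  (Set.toFinite {T | T ≤ G ∧ IsCornerForest τ π T}).toFinset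

lemma mem_cornerForests {V : Type*} [Finite V] {G T : SimpleGraph V} {τ : Fin 3 → V}
    {π : CornerPattern} : T ∈ cornerForests G τ π ↔ T ≤ G ∧ IsCornerForest τ π T :=
  Set.Finite.mem_toFinset _

lemma IsGasketGluing.sum_cornerForests_glue {V W R : Type*} [Finite V] [Finite W]
    [CommSemiring R] {τ : Fin 3 → V} {f : Fin 3 → V ↪ W} (h : IsGasketGluing τ f)
    (G : Fin 3 → SimpleGraph V) (q : CornerPattern) {w : SimpleGraph W → R}
    {v : Fin 3 → SimpleGraph V → R} (hw : ∀ T, w (glue f T) = ∏ c, v c (T c)) :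
    ∑ T ∈ cornerForests (glue f G) (fun c => f c (τ c)) q, w T =
      ∑ π with GluesTo π q, ∏ c, ∑ T ∈ cornerForests (G c) τ (π c), v c T := by
  simp only [prod_univ_sum, sum_sigma']
  symm
  refine sum_nbij (fun p => glue f p.2) ?_ ?_ ?_ fun p _ => (hw p.2).symm
  · rintro ⟨π, T⟩ hp
    simp only [mem_sigma, mem_filter_univ, Fintype.mem_piFinset, mem_cornerForests] at hp
    exact mem_cornerForests.2
      ⟨glue_mono fun c => (hp.2 c).1, h.isCornerForest_glue (fun c => (hp.2 c).2) hp.1⟩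
  · rintro ⟨π, T⟩ hp ⟨π', T'⟩ hp' heq
    simp only [mem_coe, mem_sigma, mem_filter_univ, Fintype.mem_piFinset,
      mem_cornerForests] at hp hp'
    obtain rfl : T = T' := h.glue_injective heq
    obtain rfl : π = π' := funext fun c => (hp.2 c).2.pattern_unique (hp'.2 c).2
    rfl
  · intro T hT
    obtain ⟨hle, hforest⟩ := mem_cornerForests.1 hT
    rw [← glue_comap hle] at hforest
    obtain ⟨π, hπ, hcopy⟩ := h.exists_of_isCornerForest_glue hforest
    refine ⟨⟨π, fun c => T.comap (f c)⟩, ?_, glue_comap hle⟩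
    simp only [mem_coe, mem_sigma, mem_filter_univ, Fintype.mem_piFinset, mem_cornerForests]
    exact ⟨hπ, fun c => ⟨h.comap_le hle c, hcopy c⟩⟩

end ForestSums

section Means

open Finset
open scoped BigOperators

/-- The number of ways to glue three corner forests to one with pattern `q`, counted with weights,
among those whose patterns satisfy `P`. -/
def gluingWeight (q : CornerPattern) (P : (Fin 3 → CornerPattern) → Prop) [DecidablePred P] : ℕ :=
  ∑ π with GluesTo π q ∧ P π, ∏ c, (π c).weight

/-- The weighted number of all gluings to a corner forest with `b` blocks. -/
def gluingTotal : ℕ → ℕ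
  | 1 => 6
  | 2 => 10
  | _ => 50

lemma gluingTotal_pos (b : ℕ) : 0 < gluingTotal b := by
  unfold gluingTotal
  split <;> decide

lemma sum_gluings_weight (q : CornerPattern) :
    ∑ π with GluesTo π q, ∏ c, (π c).weight = gluingTotal q.blocks := by
  decide +kernel +revert

/-- The weighted mean of `F` over the gluings to a corner forest with pattern `q`. -/
noncomputable def gluingMean (q : CornerPattern) (F : (Fin 3 → CornerPattern) → ℝ) : ℝ :=
  (∑ π with GluesTo π q, (∏ c, ((π c).weight : ℝ)) * F π) / gluingTotal q.blocks

lemma sum_gluingMean {α : Type*} [DecidableEq α] (q : CornerPattern) (K : Finset (Fin 3))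
    {s : Fin 3 → (Fin 3 → CornerPattern) → α} {S : Finset α} (hs : ∀ k π, s k π ∈ S) (g : α → ℝ) :
    ∑ k ∈ K, gluingMean q (fun π => g (s k π)) =
      (∑ a ∈ S, ((∑ k ∈ K, gluingWeight q fun π => s k π = a : ℕ) : ℝ) * g a) /
        gluingTotal q.blocks := by
  simp only [gluingMean, ← sum_div]
  congr 1
  simp only [Nat.cast_sum, sum_mul]
  rw [sum_comm (s := S)]
  refine sum_congr rfl fun k _ => ?_
  refine Eq.trans (sum_fiberwise_of_maps_to (g := s k) (fun π _ => hs k π) _).symm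
    (sum_congr rfl fun a _ => ?_)
  simp only [gluingWeight, filter_filter, Nat.cast_sum, Nat.cast_prod, sum_mul]
  refine sum_congr rfl fun π hπ => ?_
  rw [(mem_filter.1 hπ).2.2]

variable {V W : Type*} [Finite V] [Finite W] {G : SimpleGraph V} {τ : Fin 3 → V}
  {f : Fin 3 → V ↪ W}

/-- The numbers of corner forests of `G` with different patterns have the ratios which are
reproduced by gluing. -/
def IsBalanced (G : SimpleGraph V) (τ : Fin 3 → V) : Prop :=
  ∃ J r : ℝ, 0 < J ∧ 0 < r ∧
    ∀ π, (#(cornerForests G τ π) : ℝ) = J * r ^ (π.blocks - 1) * π.weight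

lemma IsBalanced.cornerForests_nonempty (hG : IsBalanced G τ) (π : CornerPattern) :
    (cornerForests G τ π).Nonempty := by
  obtain ⟨J, r, hJ, hr, hcard⟩ := hG
  have hweight : 0 < π.weight := by
    decide +revert
  have hpos : (0 : ℝ) < #(cornerForests G τ π) := by
    rw [hcard]
    positivity
  exact card_pos.1 (Nat.cast_pos.1 hpos)

/-- Three copies have three points too many, which is why the power of `r` in the number of glued
forests is determined by the pattern `q` alone. -/
lemma IsGasketGluing.sum_cornerForests_glue_eq (h : IsGasketGluing τ f)
    {J r : ℝ} (hcard : ∀ π, (#(cornerForests G τ π) : ℝ) = J * r ^ (π.blocks - 1) * π.weight)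
    (q : CornerPattern) {w : SimpleGraph W → ℝ}
    {v : Fin 3 → SimpleGraph V → ℝ} (hw : ∀ T, w (glue f T) = ∏ c, v c (T c)) :
    ∑ T ∈ cornerForests (glue f fun _ => G) (fun c => f c (τ c)) q, w T =
      J ^ 3 * r ^ q.blocks * gluingTotal q.blocks *
        gluingMean q fun π => ∏ c, 𝔼 T ∈ cornerForests G τ (π c), v c T := by
  have htotal : (gluingTotal q.blocks : ℝ) ≠ 0 := mod_cast (gluingTotal_pos _).ne'
  rw [h.sum_cornerForests_glue _ q hw, gluingMean, mul_assoc, mul_div_cancel₀ _ htotal, mul_sum]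
  refine sum_congr rfl fun π hπ => ?_
  have hexponent : ∑ c, ((π c).blocks - 1) = q.blocks := by
    have hblocks := ((mem_filter_univ _).1 hπ).sum_blocks
    have hpos : ∀ π : CornerPattern, 1 ≤ π.blocks := by decide
    have := And.intro (hpos (π 0)) (And.intro (hpos (π 1)) (hpos (π 2)))
    simp only [Fin.sum_univ_three] at hblocks ⊢
    lia
  have hcopy (c : Fin 3) : ∑ T ∈ cornerForests G τ (π c), v c T =
      J * r ^ ((π c).blocks - 1) * ((π c).weight * 𝔼 T ∈ cornerForests G τ (π c), v c T) := by
    rw [← card_smul_expect, nsmul_eq_mul, hcard, mul_assoc]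
  simp only [hcopy, prod_mul_distrib, prod_const, card_univ, Fintype.card_fin,
    prod_pow_eq_pow_sum, hexponent]

lemma gluingMean_one (q : CornerPattern) : gluingMean q (fun _ => 1) = 1 := by
  rw [gluingMean, div_eq_one_iff_eq (mod_cast (gluingTotal_pos _).ne'), ← sum_gluings_weight]
  push_cast
  simp only [mul_one]

namespace IsGasketGluing

lemma card_cornerForests_glue (h : IsGasketGluing τ f) {J r : ℝ}
    (hcard : ∀ π, (#(cornerForests G τ π) : ℝ) = J * r ^ (π.blocks - 1) * π.weight)
    (hG : IsBalanced G τ) (q : CornerPattern) :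
    (#(cornerForests (glue f fun _ => G) (fun c => f c (τ c)) q) : ℝ) =
      J ^ 3 * r ^ q.blocks * gluingTotal q.blocks := by
  have hone (π : CornerPattern) : 𝔼 _T ∈ cornerForests G τ π, (1 : ℝ) = 1 :=
    expect_const (hG.cornerForests_nonempty π) 1
  have hsum := h.sum_cornerForests_glue_eq hcard q (w := fun _ => 1) (v := fun _ _ => 1)
    fun _ => prod_const_one.symm
  simpa only [sum_const, nsmul_eq_mul, hone, prod_const_one, gluingMean_one, mul_one] using hsum

lemma isBalanced_glue (h : IsGasketGluing τ f) (hG : IsBalanced G τ) :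
    IsBalanced (glue f fun _ => G) fun c => f c (τ c) := by
  obtain ⟨J, r, hJ, hr, hcard⟩ := id hG
  refine ⟨6 * r * J ^ 3, 5 / 3 * r, by positivity, by positivity, fun q => ?_⟩
  rw [h.card_cornerForests_glue hcard hG]
  cases q <;> simp only [CornerPattern.blocks, CornerPattern.weight, gluingTotal] <;>
    push_cast <;> ring

lemma expect_cornerForests_glue (h : IsGasketGluing τ f) (hG : IsBalanced G τ) (q : CornerPattern)
    {w : SimpleGraph W → ℝ} {v : Fin 3 → SimpleGraph V → ℝ}
    (hw : ∀ T, w (glue f T) = ∏ c, v c (T c)) :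
    𝔼 T ∈ cornerForests (glue f fun _ => G) (fun c => f c (τ c)) q, w T =
      gluingMean q fun π => ∏ c, 𝔼 T ∈ cornerForests G τ (π c), v c T := by
  obtain ⟨J, r, hJ, hr, hcard⟩ := id hG
  have htotal := gluingTotal_pos q.blocks
  rw [expect_eq_sum_div_card, h.card_cornerForests_glue hcard hG,
    h.sum_cornerForests_glue_eq hcard q hw]
  exact mul_div_cancel_left₀ _ (by positivity)

lemma expect_cornerForests_glue_mul (h : IsGasketGluing τ f) (hG : IsBalanced G τ)
    (q : CornerPattern) {c d : Fin 3} (hcd : c ≠ d) {w : SimpleGraph W → ℝ}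
    {v v' : SimpleGraph V → ℝ} (hw : ∀ T, w (glue f T) = v (T c) * v' (T d)) :
    𝔼 T ∈ cornerForests (glue f fun _ => G) (fun c => f c (τ c)) q, w T =
      gluingMean q fun π =>
        (𝔼 T ∈ cornerForests G τ (π c), v T) * 𝔼 T ∈ cornerForests G τ (π d), v' T := by
  let u : Fin 3 → SimpleGraph V → ℝ := fun b => if b = c then v else if b = d then v' else 1
  have huc : u c = v := if_pos rfl
  have hud : u d = v' := (if_neg hcd.symm).trans (if_pos rfl)
  have hone {b : Fin 3} (hb : b ≠ c ∧ b ≠ d) : u b = 1 := (if_neg hb.1).trans (if_neg hb.2)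
  rw [h.expect_cornerForests_glue hG q (v := u) fun T => ?_]
  · congr 1
    funext π
    rw [Fintype.prod_eq_mul c d hcd fun b hb => ?_, huc, hud]
    rw [hone hb]
    exact expect_const (hG.cornerForests_nonempty _) 1
  · rw [hw, Fintype.prod_eq_mul c d hcd fun b hb => by rw [hone hb, Pi.one_apply], huc, hud]

lemma expect_cornerForests_glue_apply (h : IsGasketGluing τ f) (hG : IsBalanced G τ)
    (q : CornerPattern) (c : Fin 3) {w : SimpleGraph W → ℝ} {v : SimpleGraph V → ℝ}
    (hw : ∀ T, w (glue f T) = v (T c)) :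
    𝔼 T ∈ cornerForests (glue f fun _ => G) (fun c => f c (τ c)) q, w T =
      gluingMean q fun π => 𝔼 T ∈ cornerForests G τ (π c), v T := by
  have hne : ∀ c : Fin 3, c ≠ c + 1 := by decide
  rw [h.expect_cornerForests_glue_mul hG q (hne c) (v' := fun _ => 1) fun T => by rw [hw, mul_one]]
  simp only [expect_const (hG.cornerForests_nonempty _), mul_one]

end IsGasketGluing

end Means

section DegreeMeans

open Finset
open scoped BigOperators

/-- For a corner of role `ρ` in a glued corner forest, the weighted number of gluings in which it
has role `ρ'` in its own copy. -/
def CornerRole.law (ρ ρ' : CornerRole) : ℕ :=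
  match ρ, ρ' with
  | joined, joined => 4
  | joined, paired => 2
  | paired, joined => 6
  | paired, paired => 4
  | isolated, joined => 1
  | isolated, paired => 2
  | isolated, isolated => 4
  | isolated, separated => 3
  | separated, joined => 12
  | separated, paired => 14
  | separated, isolated => 12
  | separated, separated => 12
  | _, _ => 0

lemma gluingWeight_role : ∀ q i ρ',
    gluingWeight q (fun π => (π i).role i = ρ') = (q.role i).law ρ' := by
  decide +kernel

/-- The weighted number of pairs of a copy and a gluing to a forest with `b` blocks, such that the
forest in the copy has `b'` blocks. -/
def blockLaw (b b' : ℕ) : ℕ :=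
  match b, b' with
  | 1, 1 => 12
  | 1, 2 => 6
  | 2, 1 => 13
  | 2, 2 => 14
  | 2, 3 => 3
  | 3, 1 => 36
  | 3, 2 => 78
  | 3, 3 => 36
  | _, _ => 0

lemma sum_gluingWeight_blocks : ∀ q, ∀ b ∈ Icc 1 3,
    ∑ c, gluingWeight q (fun π => (π c).blocks = b) = blockLaw q.blocks b := by
  decide +kernel

/-- The weighted number of pairs of a point shared by two copies and a gluing to a forest with `b`
blocks, such that the roles of this point in the two copies are `ρ` and `ρ'`. -/
def junctionLaw (b : ℕ) (ρ ρ' : CornerRole) : ℕ :=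
  match b, ρ, ρ' with
  | 1, .joined, .joined => 6
  | 1, .joined, .paired | 1, .paired, .joined => 3
  | 1, .joined, .isolated | 1, .isolated, .joined => 3
  | 2, .joined, .joined | 2, .paired, .paired => 3
  | 2, .joined, .paired | 2, .paired, .joined => 4
  | 2, .joined, .isolated | 2, .isolated, .joined => 3
  | 2, .joined, .separated | 2, .separated, .joined => 3
  | 2, .paired, .isolated | 2, .isolated, .paired => 2
  | 3, .paired, .paired => 18
  | 3, .joined, .paired | 3, .paired, .joined => 9
  | 3, .joined, .isolated | 3, .isolated, .joined => 9
  | 3, .joined, .separated | 3, .separated, .joined => 18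
  | 3, .paired, .isolated | 3, .isolated, .paired => 12
  | 3, .paired, .separated | 3, .separated, .paired => 18
  | _, _, _ => 0

lemma sum_gluingWeight_junction : ∀ q ρ ρ',
    ∑ k : Fin 3, gluingWeight q (fun π =>
      ((π (k + 1)).role (k + 2), (π (k + 2)).role (k + 1)) = (ρ, ρ')) =
        junctionLaw q.blocks ρ ρ' := by
  decide +kernel

/-- The generating functions, evaluated at `t`, of the vertex degrees in a uniformly random corner
forest with a given pattern: that of the degree of a corner is `g`, which depends only on the role
of the corner, and the sum of those of the degrees of the other vertices is `u`, which depends only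
on the number of blocks. -/
structure HasDegreeMeans {V : Type*} [Fintype V] (G : SimpleGraph V) (τ : Fin 3 → V) (t : ℝ)
    (g : CornerRole → ℝ) (u : ℕ → ℝ) : Prop where
  isBalanced : IsBalanced G τ
  corner : ∀ π i, 𝔼 T ∈ cornerForests G τ π, t ^ (T.neighborSet (τ i)).ncard = g (π.role i)
  interior : ∀ π, 𝔼 T ∈ cornerForests G τ π,
    ∑ x ∈ interiorVertices τ, t ^ (T.neighborSet x).ncard = u π.blocks

/-- The effect of a gluing on the generating functions of the degrees of the corners. -/
noncomputable def cornerStep (g : CornerRole → ℝ) (ρ : CornerRole) : ℝ :=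
  (∑ ρ', ρ.law ρ' * g ρ') / (∑ ρ', ρ.law ρ' : ℕ)

/-- The contribution of the points shared by two copies to the sum of the generating functions of
the degrees, in a glued corner forest with `b` blocks. -/
noncomputable def junctionTerm (g : CornerRole → ℝ) (b : ℕ) : ℝ :=
  (∑ p : CornerRole × CornerRole, junctionLaw b p.1 p.2 * (g p.1 * g p.2)) / gluingTotal b

/-- The effect of a gluing on the sum of the generating functions of the degrees of the vertices
other than the corners. -/
noncomputable def interiorStep (g : CornerRole → ℝ) (u : ℕ → ℝ) (b : ℕ) : ℝ :=
  (∑ b' ∈ Icc 1 3, blockLaw b b' * u b') / gluingTotal b + junctionTerm g b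

lemma gluingMean_role (q : CornerPattern) (i : Fin 3) (g : CornerRole → ℝ) :
    gluingMean q (fun π => g ((π i).role i)) = cornerStep g (q.role i) := by
  have hsum := sum_gluingMean q {i} (s := fun i π => (π i).role i)
    (fun _ _ => mem_univ _) g
  have htotal : ∀ q i, ∑ ρ', (CornerPattern.role i q).law ρ' = gluingTotal q.blocks := by decide
  simpa only [sum_singleton, gluingWeight_role, ← htotal q i, cornerStep] using hsum

lemma sum_gluingMean_blocks (q : CornerPattern) (u : ℕ → ℝ) :
    ∑ c, gluingMean q (fun π => u (π c).blocks) =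
      (∑ b ∈ Icc 1 3, blockLaw q.blocks b * u b) / gluingTotal q.blocks := by
  have hblocks : ∀ π : CornerPattern, π.blocks ∈ Icc 1 3 := by decide
  rw [sum_gluingMean q univ (s := fun c π => (π c).blocks) (fun c π => hblocks (π c)) u]
  exact congrArg (· / _) (sum_congr rfl fun b hb => by rw [sum_gluingWeight_blocks q b hb])

lemma sum_gluingMean_junction (q : CornerPattern) (g : CornerRole → ℝ) :
    ∑ k : Fin 3, gluingMean q
      (fun π => g ((π (k + 1)).role (k + 2)) * g ((π (k + 2)).role (k + 1))) =
        junctionTerm g q.blocks := by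
  rw [sum_gluingMean q univ
    (s := fun k π => ((π (k + 1)).role (k + 2), (π (k + 2)).role (k + 1)))
    (fun _ _ => mem_univ _) fun p => g p.1 * g p.2]
  simp only [sum_gluingWeight_junction, junctionTerm]

lemma HasDegreeMeans.glue {V W : Type*} [Fintype V] [Fintype W] {G : SimpleGraph V}
    {τ : Fin 3 → V} {f : Fin 3 → V ↪ W} (h : IsGasketGluing τ f) {t : ℝ} {g : CornerRole → ℝ}
    {u : ℕ → ℝ} (hG : HasDegreeMeans G τ t g u) :
    HasDegreeMeans (glue f fun _ => G) (fun c => f c (τ c)) t (cornerStep g)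
      (interiorStep g u) where
  isBalanced := h.isBalanced_glue hG.isBalanced
  corner q i := by
    rw [h.expect_cornerForests_glue_apply hG.isBalanced q i
      (v := fun T => t ^ (T.neighborSet (τ i)).ncard) fun T => ?_]
    · simp only [hG.corner, gluingMean_role]
    · rw [h.ncard_neighborSet_glue T fun d hd => h.corner_injective.ne hd.symm]
  interior q := by
    have hcopy (c : Fin 3) :=
      h.expect_cornerForests_glue_apply hG.isBalanced q c
        (w := fun T => ∑ x ∈ interiorVertices τ, t ^ (T.neighborSet (f c x)).ncard)
        (v := fun T => ∑ x ∈ interiorVertices τ, t ^ (T.neighborSet x).ncard) fun T =>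
          sum_congr rfl fun x hx => by
            rw [h.ncard_neighborSet_glue T fun d _ => mem_interiorVertices.1 hx d]
    have hne : ∀ k : Fin 3, k + 1 ≠ k + 2 := by decide
    have hjunction (k : Fin 3) :=
      h.expect_cornerForests_glue_mul hG.isBalanced q (hne k)
        (w := fun T => t ^ (T.neighborSet (f (k + 1) (τ (k + 2)))).ncard)
        (v := fun T => t ^ (T.neighborSet (τ (k + 2))).ncard)
        (v' := fun T => t ^ (T.neighborSet (τ (k + 1))).ncard) fun T => by
          rw [h.ncard_neighborSet_glue_junction T (hne k), pow_add]
    simp only [h.sum_interiorVertices, expect_add_distrib, expect_sum_comm _ univ, hcopy,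
      hjunction, hG.interior, hG.corner, sum_gluingMean_blocks, sum_gluingMean_junction,
      interiorStep]

end DegreeMeans

section Recursion

open Filter Topology Finset

/-- The generating function at `t` of the degree of a corner of `SG n` in a uniformly random corner
forest, depending on the role of the corner: the solution of the recursion `cornerStep`. -/
noncomputable def cornerMean (t : ℝ) (n : ℕ) : CornerRole → ℝ
  | .joined => (11 * t + 3 * t ^ 2) / 14 + 5 * (t ^ 2 - t) / 42 * (1 / 15) ^ n
  | .paired => (11 * t + 3 * t ^ 2) / 14 - 3 * (t ^ 2 - t) / 14 * (1 / 15) ^ n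
  | .isolated => (11 * t + 3 * t ^ 2) / 14 + 2 * (t ^ 2 - t) / 7 * (1 / 15) ^ n
      + 3 * (1 - t) * (11 + 3 * t) / 28 * (3 / 5) ^ n - 5 * (1 - t) ^ 2 / 28 * (1 / 25) ^ n
  | .separated => (11 * t + 3 * t ^ 2) / 14 - 3 * (t ^ 2 - t) / 14 * (1 / 15) ^ n
      + (1 - t) * (11 + 3 * t) / 14 * (3 / 5) ^ n + 3 * (1 - t) ^ 2 / 14 * (1 / 25) ^ n

lemma CornerRole.sum_univ {M : Type*} [AddCommMonoid M] (F : CornerRole → M) :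
    ∑ ρ, F ρ = F .joined + (F .paired + (F .isolated + F .separated)) := by
  change ∑ ρ ∈ {.joined, .paired, .isolated, .separated}, F ρ = _
  simp

lemma cornerStep_cornerMean (t : ℝ) (n : ℕ) :
    cornerStep (cornerMean t n) = cornerMean t (n + 1) := by
  funext ρ
  cases ρ <;> simp only [cornerStep, CornerRole.sum_univ, CornerRole.law, cornerMean] <;>
    push_cast <;> ring

/-- The sum of the generating functions at `t` of the degrees of the vertices of `SG n` other than
the corners in a uniformly random corner forest with a given number of blocks. -/
noncomputable def interiorMean (t : ℝ) : ℕ → ℕ → ℝ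
  | 0 => 0
  | n + 1 => interiorStep (cornerMean t n) (interiorMean t n)

lemma junctionTerm_one (g : CornerRole → ℝ) :
    junctionTerm g 1 = g .joined * (g .joined + g .paired + g .isolated) := by
  simp only [junctionTerm, Fintype.sum_prod_type, CornerRole.sum_univ, junctionLaw, gluingTotal]
  push_cast
  ring

lemma junctionTerm_two (g : CornerRole → ℝ) :
    junctionTerm g 2 = (3 * (g .joined ^ 2 + g .paired ^ 2) + 8 * (g .joined * g .paired) +
      6 * (g .joined * (g .isolated + g .separated)) + 4 * (g .paired * g .isolated)) / 10 := by
  simp only [junctionTerm, Fintype.sum_prod_type, CornerRole.sum_univ, junctionLaw, gluingTotal]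
  push_cast
  ring

lemma junctionTerm_three (g : CornerRole → ℝ) :
    junctionTerm g 3 = (9 * (g .paired ^ 2 + g .joined * (g .paired + g .isolated)) +
      18 * (g .separated * (g .joined + g .paired)) + 12 * (g .paired * g .isolated)) / 25 := by
  simp only [junctionTerm, Fintype.sum_prod_type, CornerRole.sum_univ, junctionLaw, gluingTotal]
  push_cast
  ring

lemma interiorStep_one (g : CornerRole → ℝ) (u : ℕ → ℝ) :
    interiorStep g u 1 = (12 * u 1 + 6 * u 2) / 6 + junctionTerm g 1 := by
  have hIcc : Icc 1 3 = {1, 2, 3} := rfl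
  simp [interiorStep, hIcc, blockLaw, gluingTotal]

lemma interiorStep_two (g : CornerRole → ℝ) (u : ℕ → ℝ) :
    interiorStep g u 2 = (13 * u 1 + 14 * u 2 + 3 * u 3) / 10 + junctionTerm g 2 := by
  have hIcc : Icc 1 3 = {1, 2, 3} := rfl
  simp [interiorStep, hIcc, blockLaw, gluingTotal, add_assoc]

lemma interiorStep_three (g : CornerRole → ℝ) (u : ℕ → ℝ) :
    interiorStep g u 3 = (36 * u 1 + 78 * u 2 + 36 * u 3) / 50 + junctionTerm g 3 := by
  have hIcc : Icc 1 3 = {1, 2, 3} := rfl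
  simp [interiorStep, hIcc, blockLaw, gluingTotal, add_assoc]

/-- The limit of the generating function at `t` of the degree of a uniformly random vertex of a
uniformly random spanning tree of `SG n`. -/
noncomputable def limitMean (t : ℝ) : ℝ :=
  10957 / 40464 * t + 6626035 / 13636368 * t ^ 2 + 2943139 / 13636368 * t ^ 3 +
    124895 / 4545456 * t ^ 4

/-- `(53, 38, 5)` is the left eigenvector, of eigenvalue `3`, of the matrix of `interiorStep`. -/
lemma interiorMean_eigenvector_three (t : ℝ) (n : ℕ) :
    (53 * interiorMean t n 1 + 38 * interiorMean t n 2 + 5 * interiorMean t n 3) / 96 =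
      3 / 2 * limitMean t * 3 ^ n - ((363 * t ^ 2 + 198 * t ^ 3 + 27 * t ^ 4) / 392 +
        (-33 * t ^ 2 + 24 * t ^ 3 + 9 * t ^ 4) / 392 * (1 / 15) ^ n +
        (275 * t ^ 2 - 550 * t ^ 3 + 275 * t ^ 4) / 198156 * (1 / 225) ^ n +
        (363 * t - 165 * t ^ 2 - 171 * t ^ 3 - 27 * t ^ 4) / 784 * (3 / 5) ^ n +
        (-275 * t + 475 * t ^ 2 - 125 * t ^ 3 - 75 * t ^ 4) / 4704 * (1 / 25) ^ n +
        (1075 * t - 3225 * t ^ 2 + 3225 * t ^ 3 - 1075 * t ^ 4) / 660912 * (1 / 375) ^ n) := by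
  have hpow_25 (n : ℕ) : (1 / 25 : ℝ) ^ n = (1 / 15) ^ n * (3 / 5) ^ n := by
    rw [← mul_pow]
    norm_num
  have hpow_225 (n : ℕ) : (1 / 225 : ℝ) ^ n = (1 / 15) ^ n * (1 / 15) ^ n := by
    rw [← mul_pow]
    norm_num
  have hpow_375 (n : ℕ) : (1 / 375 : ℝ) ^ n = (1 / 15) ^ n * ((1 / 15) ^ n * (3 / 5) ^ n) := by
    rw [← mul_pow, ← mul_pow]
    norm_num
  simp only [hpow_25, hpow_225, hpow_375]
  induction n with
  | zero =>
    simp only [interiorMean, limitMean, Pi.zero_apply]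
    ring
  | succ n ih =>
    simp only [interiorMean, interiorStep_one, interiorStep_two, interiorStep_three,
      junctionTerm_one, junctionTerm_two, junctionTerm_three, cornerMean, limitMean,
      hpow_25, pow_succ] at ih ⊢
    linear_combination 3 * ih

lemma tendsto_cornerMean (t : ℝ) (ρ : CornerRole) :
    Tendsto (fun n => cornerMean t n ρ) atTop (𝓝 ((11 * t + 3 * t ^ 2) / 14)) := by
  have hpow (c : ℝ) {r : ℝ} (hr : r ∈ Set.Ico 0 1) := tendsto_const_mul_pow c hr
  have h15 : (1 / 15 : ℝ) ∈ Set.Ico 0 1 := by norm_num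
  have h25 : (1 / 25 : ℝ) ∈ Set.Ico 0 1 := by norm_num
  have h35 : (3 / 5 : ℝ) ∈ Set.Ico 0 1 := by norm_num
  cases ρ with
  | joined => simpa only [cornerMean, add_zero] using (hpow _ h15).const_add _
  | paired => simpa only [cornerMean, sub_zero] using (hpow _ h15).const_sub _
  | isolated =>
    simpa only [cornerMean, add_zero, sub_zero] using
      (((hpow _ h15).const_add _).add (hpow _ h35)).sub (hpow _ h25)
  | separated =>
    simpa only [cornerMean, add_zero, sub_zero] using
      (((hpow _ h15).const_sub _).add (hpow _ h35)).add (hpow _ h25)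

lemma exists_abs_junctionTerm_cornerMean_le (t : ℝ) (b : ℕ) :
    ∃ M, ∀ n, |junctionTerm (cornerMean t n) b| ≤ M := by
  have hcont : Continuous fun g => junctionTerm g b := by
    unfold junctionTerm
    fun_prop
  have hlim := (hcont.tendsto _).comp (tendsto_pi_nhds.2 (tendsto_cornerMean t))
  obtain ⟨M, hM⟩ := (Metric.isBounded_range_of_tendsto _ hlim).exists_norm_le
  exact ⟨M, fun n => hM _ (Set.mem_range_self n)⟩

lemma tendsto_interiorMean_eigenvector_div (t : ℝ) {a b c μ : ℝ} (hμ : |μ| ≤ 1)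
    (heigen : ∀ g u,
      a * interiorStep g u 1 + b * interiorStep g u 2 + c * interiorStep g u 3 =
        μ * (a * u 1 + b * u 2 + c * u 3) +
          (a * junctionTerm g 1 + b * junctionTerm g 2 + c * junctionTerm g 3)) :
    Tendsto (fun n => (a * interiorMean t n 1 + b * interiorMean t n 2 + c * interiorMean t n 3) /
      3 ^ n) atTop (𝓝 0) := by
  choose M hM using exists_abs_junctionTerm_cornerMean_le t
  refine tendsto_div_pow_atTop_nhds_zero (M := |a| * M 1 + |b| * M 2 + |c| * M 3) (by norm_num)
    fun n => ?_
  rw [interiorMean, heigen]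
  refine (abs_add_le _ _).trans (add_le_add ?_ ((abs_add_three _ _ _).trans ?_))
  · rw [abs_mul]
    exact mul_le_of_le_one_left (abs_nonneg _) hμ
  · simp only [abs_mul]
    gcongr <;> exact hM _ n

lemma tendsto_interiorMean_eigenvector_three_div (t : ℝ) :
    Tendsto (fun n => (53 * interiorMean t n 1 + 38 * interiorMean t n 2 +
      5 * interiorMean t n 3) / 96 / 3 ^ n) atTop (𝓝 (3 / 2 * limitMean t)) := by
  have hpow (c : ℝ) {r : ℝ} (hr : r ∈ Set.Ico 0 1) := tendsto_const_mul_pow c hr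
  have hthree : Tendsto (fun n : ℕ => (3 : ℝ) ^ n) atTop atTop :=
    tendsto_pow_atTop_atTop_of_one_lt (by norm_num)
  simp only [interiorMean_eigenvector_three, sub_div _ _ ((3 : ℝ) ^ _),
    mul_div_cancel_right₀ _ (pow_ne_zero _ (three_ne_zero (α := ℝ)))]
  suffices hlim : Tendsto _ _ (𝓝 (3 / 2 * limitMean t - 0)) by simpa only [sub_zero] using hlim
  refine tendsto_const_nhds.sub (Tendsto.div_atTop (((((tendsto_const_nhds.add (hpow _ ?_)).add
    (hpow _ ?_)).add (hpow _ ?_)).add (hpow _ ?_)).add (hpow _ ?_)) hthree) <;> norm_num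

lemma tendsto_interiorMean_div (t : ℝ) :
    Tendsto (fun n => interiorMean t n 1 / 3 ^ n) atTop (𝓝 (3 / 2 * limitMean t)) := by
  -- `(-29, 14, 15)` and `(1, -2, 1)` are the left eigenvectors of the eigenvalues `1` and `3 / 25`.
  have hone := tendsto_interiorMean_eigenvector_div t (a := -29) (b := 14) (c := 15) (μ := 1)
    (by norm_num) fun g u => by
      rw [interiorStep_one, interiorStep_two, interiorStep_three]
      ring
  have hsmall := tendsto_interiorMean_eigenvector_div t (a := 1) (b := -2) (c := 1) (μ := 3 / 25)
    (by rw [abs_of_nonneg] <;> norm_num) fun g u => by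
      rw [interiorStep_one, interiorStep_two, interiorStep_three]
      ring
  have hsum := ((tendsto_interiorMean_eigenvector_three_div t).sub (hone.div_const 88)).add
    (hsmall.const_mul (125 / 1056))
  simp only [zero_div, mul_zero, sub_zero, add_zero] at hsum
  refine hsum.congr fun n => ?_
  ring

end Recursion

section Triangle

open Finset
open scoped BigOperators

variable {V : Type*} (e : Fin 3 ≃ V)

/-- The subgraphs of a triangle with corners `e i`. The subgraph corresponding to `b` contains the
edge opposite to the corner `k` if `b k` is true; note that `-(i + j)` is the third element of
`Fin 3` besides `i ≠ j`. -/
noncomputable def triangleSubgraph : (Fin 3 → Bool) ≃ SimpleGraph V where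
  toFun b :=
    { Adj x y := x ≠ y ∧ b (-(e.symm x + e.symm y))
      symm := ⟨fun x y hxy => ⟨hxy.1.symm, add_comm (e.symm x) _ ▸ hxy.2⟩⟩
      loopless := ⟨fun _ hx => hx.1 rfl⟩ }
  invFun T k := open Classical in decide (T.Adj (e (k + 1)) (e (k + 2)))
  left_inv b := by
    funext k
    have hk : ∀ k : Fin 3, k + 1 ≠ k + 2 ∧ -(k + 1 + (k + 2)) = k := by decide
    simp [hk]
  right_inv T := by
    classical
    ext x y
    obtain ⟨i, rfl⟩ := e.surjective x
    obtain ⟨j, rfl⟩ := e.surjective y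
    have hthird : ∀ i j : Fin 3, i = j ∨ (-(i + j) + 1 = i ∧ -(i + j) + 2 = j) ∨
        (-(i + j) + 1 = j ∧ -(i + j) + 2 = i) := by decide
    change _ ∧ decide _ = true ↔ _
    rw [e.symm_apply_apply, e.symm_apply_apply, decide_eq_true_iff]
    obtain rfl | ⟨hi, hj⟩ | ⟨hj, hi⟩ := hthird i j
    · simp only [ne_eq, not_true_eq_false, false_and, SimpleGraph.irrefl]
    · rw [hi, hj]
      exact and_iff_right_of_imp SimpleGraph.Adj.ne
    · rw [hi, hj, T.adj_comm]
      exact and_iff_right_of_imp SimpleGraph.Adj.ne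

lemma triangleSubgraph_adj {b : Fin 3 → Bool} {i j : Fin 3} :
    (triangleSubgraph e b).Adj (e i) (e j) ↔ i ≠ j ∧ b (-(i + j)) := by
  change e i ≠ e j ∧ b (-(e.symm (e i) + e.symm (e j))) ↔ _
  rw [e.symm_apply_apply, e.symm_apply_apply, e.injective.ne_iff]

/-- The degree of the corner `i` in `triangleSubgraph e b`. -/
def triangleDegree (b : Fin 3 → Bool) (i : Fin 3) : ℕ :=
  (b (i + 1)).toNat + (b (i + 2)).toNat

lemma ncard_neighborSet_triangleSubgraph (b : Fin 3 → Bool) (i : Fin 3) :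
    ((triangleSubgraph e b).neighborSet (e i)).ncard = triangleDegree b i := by
  have himage : (triangleSubgraph e b).neighborSet (e i) =
      e '' (({j | i ≠ j ∧ b (-(i + j))} : Finset (Fin 3)) : Set (Fin 3)) := by
    ext x
    obtain ⟨j, rfl⟩ := e.surjective x
    simp [triangleSubgraph_adj]
  rw [himage, Set.ncard_image_of_injective _ e.injective, Set.ncard_coe_finset]
  clear himage
  decide +revert

lemma card_edgeSet_triangleSubgraph (b : Fin 3 → Bool) :
    Nat.card (triangleSubgraph e b).edgeSet = ∑ k, (b k).toNat := by
  classical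
  have := Fintype.ofEquiv _ e
  have hdegree (i : Fin 3) : (triangleSubgraph e b).degree (e i) = triangleDegree b i := by
    rw [← ncard_neighborSet_triangleSubgraph e, ← Nat.card_coe_set_eq, Nat.card_eq_fintype_card,
      SimpleGraph.card_neighborSet_eq_degree]
  have htwice := (triangleSubgraph e b).sum_degrees_eq_twice_card_edges
  rw [← e.sum_comp] at htwice
  rw [Nat.card_eq_fintype_card, ← SimpleGraph.edgeFinset_card]
  simp only [hdegree, triangleDegree, Fin.sum_univ_three] at htwice ⊢
  simp only [Fin.reduceAdd, Fin.isValue, zero_add] at htwice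
  lia

/-- Whether `triangleSubgraph e b` connects the corners `i` and `j`. -/
def triangleRel (b : Fin 3 → Bool) (i j : Fin 3) : Bool :=
  i = j || b (-(i + j)) || (b i && b j)

lemma reachable_triangleSubgraph_iff {b : Fin 3 → Bool} {i j : Fin 3} :
    (triangleSubgraph e b).Reachable (e i) (e j) ↔ triangleRel b i j := by
  refine ⟨fun hij => ?_, fun hij => ?_⟩
  · rw [SimpleGraph.reachable_iff_reflTransGen] at hij
    generalize hx : e j = x at hij
    induction hij generalizing j with
    | refl => simp [triangleRel, e.injective hx]
    | @tail y _ _ hadj ih =>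
      obtain ⟨k, rfl⟩ := e.surjective y
      subst hx
      have hstep : ∀ b i k j, triangleRel b i k → k ≠ j ∧ b (-(k + j)) → triangleRel b i j := by
        decide
      exact hstep b i k j (ih rfl) ((triangleSubgraph_adj e).1 hadj)
  · have hcases : ∀ b i j, triangleRel b i j → i = j ∨ (i ≠ j ∧ b (-(i + j))) ∨
        ∃ k, (i ≠ k ∧ b (-(i + k))) ∧ k ≠ j ∧ b (-(k + j)) := by
      decide
    simp only [← triangleSubgraph_adj e] at hcases
    obtain rfl | hadj | ⟨k, hik, hkj⟩ := hcases b i j hij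
    · rfl
    · exact hadj.reachable
    · exact hik.reachable.trans hkj.reachable

lemma isCornerForest_triangleSubgraph_iff {π : CornerPattern} {b : Fin 3 → Bool} :
    IsCornerForest e π (triangleSubgraph e b) ↔
      (∀ i j, triangleRel b i j = π.rel i j) ∧ ∑ k, (b k).toNat + π.blocks = 3 := by
  have hpattern : cornerRel e (triangleSubgraph e b) = π.toSetoid ↔
      ∀ i j, triangleRel b i j = π.rel i j := by
    refine Setoid.ext_iff.trans (forall₂_congr fun i j => ?_)
    rw [Bool.eq_iff_iff, ← reachable_triangleSubgraph_iff e]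
    rfl
  have hcard : Nat.card V = 3 := by
    rw [← Nat.card_congr e, Nat.card_fin]
  rw [← hpattern, ← card_edgeSet_triangleSubgraph e]
  refine ⟨fun hT => ⟨hT.pattern, hT.card_edgeSet.trans hcard⟩,
    fun hT => ⟨fun x => ?_, hT.1, hT.2.trans hcard.symm⟩⟩
  exact ⟨e.symm x, by rw [e.apply_symm_apply]⟩

/-- The `b` for which `triangleSubgraph e b` is a corner forest with pattern `π`. -/
def triangleForests (π : CornerPattern) : Finset (Fin 3 → Bool) :=
  {b | (∀ i j, triangleRel b i j = π.rel i j) ∧ ∑ k, (b k).toNat + π.blocks = 3}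

lemma cornerForests_top [Finite V] (π : CornerPattern) :
    cornerForests ⊤ e π = (triangleForests π).map (triangleSubgraph e).toEmbedding := by
  ext T
  obtain ⟨b, rfl⟩ := (triangleSubgraph e).surjective T
  simp only [mem_cornerForests, le_top, true_and, isCornerForest_triangleSubgraph_iff,
    triangleForests, mem_map_equiv, Equiv.symm_apply_apply, mem_filter_univ]

/-- The degrees of a corner of a triangle in the corner forests in which it has the given role. -/
def CornerRole.triangleDegrees : CornerRole → Multiset ℕ
  | joined => {1, 1, 2}
  | paired => {1}
  | isolated => {0}
  | separated => {0}

lemma map_triangleDegree_triangleForests : ∀ π i,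
    (triangleForests π).val.map (triangleDegree · i) = (π.role i).triangleDegrees := by
  decide +kernel

lemma isBalanced_top [Finite V] : IsBalanced ⊤ e := by
  refine ⟨3, 1 / 3, by norm_num, by norm_num, fun π => ?_⟩
  have hcard : ∀ π, #(triangleForests π) * 3 ^ (π.blocks - 1) = 3 * π.weight := by
    decide +kernel
  rw [cornerForests_top, card_map, one_div_pow, mul_one_div, div_mul_eq_mul_div,
    eq_div_iff (by positivity)]
  exact_mod_cast hcard π

lemma hasDegreeMeans_top [Fintype V] (t : ℝ) : HasDegreeMeans ⊤ e t (cornerMean t 0) 0 where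
  isBalanced := isBalanced_top e
  corner π i := by
    have hdegrees := map_triangleDegree_triangleForests π i
    have hcard := congrArg Multiset.card hdegrees
    have hsum := congrArg (fun s => (s.map (t ^ ·)).sum) hdegrees
    simp only [Multiset.map_map, Function.comp_apply, Multiset.card_map, card_val] at hcard hsum
    rw [expect_eq_sum_div_card, cornerForests_top, sum_map, card_map, hcard]
    simp only [Equiv.coe_toEmbedding, ncard_neighborSet_triangleSubgraph]
    refine (congrArg (· / _) hsum).trans ?_
    cases π.role i <;> simp [CornerRole.triangleDegrees, cornerMean] <;> ring
  interior π := by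
    have hempty : interiorVertices e = ∅ := eq_empty_of_forall_notMem fun x hx =>
      mem_interiorVertices.1 hx (e.symm x) (e.apply_symm_apply x).symm
    simp only [hempty, sum_empty, expect_const_zero, Pi.zero_apply]

end Triangle

section Gasket

open Finset
open scoped BigOperators

/-- The position of the corner `c` of `SG n`; also the translation carrying `SG n` to its copy at
the corner `c` of `SG (n + 1)`. -/
def sgOffset (n : ℕ) : Fin 3 → ℕ × ℕ := ![(0, 0), (2 ^ n, 0), (0, 2 ^ n)]

lemma sgOffset_succ (n : ℕ) (c : Fin 3) : sgOffset (n + 1) c = sgOffset n c + sgOffset n c := by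
  fin_cases c <;> simp [sgOffset, pow_succ, mul_two]

lemma sgOffset_injective (n : ℕ) : Function.Injective (sgOffset n) := by
  have hpos : 2 ^ n ≠ 0 := by positivity
  intro i j
  fin_cases i <;> fin_cases j <;> simp [sgOffset, hpos.symm]

lemma mem_sgVertices_succ {n : ℕ} {q : ℕ × ℕ} :
    q ∈ sgVertices (n + 1) ↔ ∃ c, ∃ p ∈ sgVertices n, p + sgOffset n c = q := by
  simp [sgVertices, sgOffset, Fin.exists_fin_succ, Prod.ext_iff]

lemma mem_sgEdges_succ {n : ℕ} {e : Sym2 (ℕ × ℕ)} :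
    e ∈ sgEdges (n + 1) ↔ ∃ c, ∃ e' ∈ sgEdges n, e'.map (· + sgOffset n c) = e := by
  have hzero : (fun p : ℕ × ℕ => p + (0, 0)) = id := funext add_zero
  simp [sgEdges, sgOffset, Fin.exists_fin_succ, hzero]

lemma sgOffset_mem (n : ℕ) (c : Fin 3) : sgOffset n c ∈ sgVertices n := by
  induction n with
  | zero => fin_cases c <;> simp [sgOffset, sgVertices]
  | succ n ih => exact mem_sgVertices_succ.2 ⟨c, _, ih, (sgOffset_succ n c).symm⟩

lemma add_le_of_mem_sgVertices {n : ℕ} {p : ℕ × ℕ} (hp : p ∈ sgVertices n) :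
    p.1 + p.2 ≤ 2 ^ n := by
  induction n generalizing p with
  | zero => revert p; decide
  | succ n ih =>
    obtain ⟨c, q, hq, rfl⟩ := mem_sgVertices_succ.1 hp
    have hle := ih hq
    fin_cases c <;> simp [sgOffset, pow_succ] <;> lia

lemma mem_sgVertices_of_mem_sgEdges {n : ℕ} {e : Sym2 (ℕ × ℕ)} (he : e ∈ sgEdges n) {p : ℕ × ℕ}
    (hp : p ∈ e) : p ∈ sgVertices n := by
  induction n generalizing e p with
  | zero =>
    have hmem : ∀ e ∈ sgEdges 0, e.toFinset ⊆ sgVertices 0 := by decide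
    exact hmem e he (Sym2.mem_toFinset.2 hp)
  | succ n ih =>
    obtain ⟨c, e', he', rfl⟩ := mem_sgEdges_succ.1 he
    obtain ⟨q, hq, rfl⟩ := Sym2.mem_map.1 hp
    exact mem_sgVertices_succ.2 ⟨c, q, ih he' hq, rfl⟩

/-- The corners of `SG n`. -/
def sgCorner (n : ℕ) (c : Fin 3) : sgVertices n := ⟨sgOffset n c, sgOffset_mem n c⟩

/-- The embedding of `SG n` onto its copy at the corner `c` of `SG (n + 1)`. -/
def sgEmbedding (n : ℕ) (c : Fin 3) : sgVertices n ↪ sgVertices (n + 1) where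
  toFun p := ⟨p + sgOffset n c, mem_sgVertices_succ.2 ⟨c, p, p.2, rfl⟩⟩
  inj' _ _ hpq := Subtype.ext (add_right_cancel (Subtype.ext_iff.1 hpq))

lemma sgCorner_succ (n : ℕ) :
    sgCorner (n + 1) = fun c => sgEmbedding n c (sgCorner n c) :=
  funext fun c => Subtype.ext (sgOffset_succ n c)

lemma isGasketGluing_sgEmbedding (n : ℕ) : IsGasketGluing (sgCorner n) (sgEmbedding n) where
  corner_injective _ _ hij := sgOffset_injective n (Subtype.ext_iff.1 hij)
  joint_comm _ _ := Subtype.ext (add_comm _ _)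
  eq_corner := by
    rintro c d ⟨⟨x, x'⟩, hx⟩ ⟨⟨y, y'⟩, hy⟩ hxy hcd
    have hlex := add_le_of_mem_sgVertices hx
    have hley := add_le_of_mem_sgVertices hy
    replace hxy : (x, x') + sgOffset n c = (y, y') + sgOffset n d := congrArg Subtype.val hxy
    refine Subtype.ext ?_
    change (x, x') = sgOffset n d
    fin_cases c <;> fin_cases d <;> simp [sgOffset, Prod.ext_iff] at * <;> lia
  exists_eq := by
    rintro ⟨q, hq⟩
    obtain ⟨c, p, hp, rfl⟩ := mem_sgVertices_succ.1 hq
    exact ⟨c, ⟨p, hp⟩, rfl⟩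

lemma SG_succ (n : ℕ) : SG (n + 1) = glue (sgEmbedding n) fun _ => SG n := by
  ext v w
  rw [glue_adj]
  refine ⟨fun ⟨hne, hvw⟩ => ?_, ?_⟩
  · obtain ⟨c, ⟨x, y⟩, hxy, heq⟩ := mem_sgEdges_succ.1 hvw
    have hx := mem_sgVertices_of_mem_sgEdges hxy (Sym2.mem_mk_left x y)
    have hy := mem_sgVertices_of_mem_sgEdges hxy (Sym2.mem_mk_right x y)
    have hadj (hne : x ≠ y) : (SG n).Adj ⟨x, hx⟩ ⟨y, hy⟩ := ⟨Subtype.coe_ne_coe.1 hne, hxy⟩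
    obtain ⟨hv, hw⟩ | ⟨hw, hv⟩ := Sym2.eq_iff.1 heq
    · refine ⟨c, _, _, hadj ?_, Subtype.ext hv, Subtype.ext hw⟩
      rintro rfl
      exact hne (Subtype.ext (hv.symm.trans hw))
    · refine ⟨c, _, _, (hadj ?_).symm, Subtype.ext hv, Subtype.ext hw⟩
      rintro rfl
      exact hne (Subtype.ext (hv.symm.trans hw))
  · rintro ⟨c, x, y, ⟨hne, hxy⟩, rfl, rfl⟩
    exact ⟨(sgEmbedding n c).injective.ne hne, mem_sgEdges_succ.2 ⟨c, _, hxy, rfl⟩⟩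

lemma SG_zero : SG 0 = ⊤ := by
  have hedges : ∀ x ∈ sgVertices 0, ∀ y ∈ sgVertices 0, x ≠ y → s(x, y) ∈ sgEdges 0 := by decide
  ext x y
  exact ⟨SimpleGraph.Adj.ne, fun hne =>
    ⟨hne, hedges x x.2 y y.2 (Subtype.coe_ne_coe.2 hne)⟩⟩

lemma card_sgVertices_zero : #(sgVertices 0) = 3 := rfl

lemma sgCorner_zero_bijective : Function.Bijective (sgCorner 0) :=
  (Fintype.bijective_iff_injective_and_card _).2
    ⟨(isGasketGluing_sgEmbedding 0).corner_injective,
      by rw [Fintype.card_coe, card_sgVertices_zero, Fintype.card_fin]⟩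

lemma hasDegreeMeans_SG (t : ℝ) (n : ℕ) :
    HasDegreeMeans (SG n) (sgCorner n) t (cornerMean t n) (interiorMean t n) := by
  induction n with
  | zero =>
    rw [SG_zero]
    exact hasDegreeMeans_top (Equiv.ofBijective _ sgCorner_zero_bijective) t
  | succ n ih =>
    rw [SG_succ, sgCorner_succ, ← cornerStep_cornerMean]
    exact ih.glue (isGasketGluing_sgEmbedding n)

lemma two_mul_card_sgVertices (n : ℕ) : 2 * #(sgVertices n) = 3 * (3 ^ n + 1) := by
  induction n with
  | zero => rfl
  | succ n ih =>
    have hcard := (isGasketGluing_sgEmbedding n).card_add_three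
    simp only [Nat.card_eq_fintype_card, Fintype.card_coe] at hcard
    rw [pow_succ]
    lia

lemma ncard_neighborSet_sgCorner_le (n : ℕ) (i : Fin 3) :
    ((SG n).neighborSet (sgCorner n i)).ncard ≤ 2 := by
  induction n with
  | zero =>
    rw [SG_zero, SimpleGraph.neighborSet_top, Set.ncard_compl, Set.ncard_singleton,
      Nat.card_eq_fintype_card, Fintype.card_coe, card_sgVertices_zero]
  | succ n ih =>
    have h := isGasketGluing_sgEmbedding n
    rw [SG_succ, sgCorner_succ,
      h.ncard_neighborSet_glue _ fun d hd => h.corner_injective.ne hd.symm]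
    exact ih

lemma ncard_neighborSet_SG_le (n : ℕ) (x : sgVertices n) : ((SG n).neighborSet x).ncard ≤ 4 := by
  induction n with
  | zero =>
    obtain ⟨i, rfl⟩ := sgCorner_zero_bijective.surjective x
    exact (ncard_neighborSet_sgCorner_le 0 i).trans (by norm_num)
  | succ n ih =>
    have h := isGasketGluing_sgEmbedding n
    obtain ⟨c, x, rfl⟩ := h.exists_eq x
    rw [SG_succ]
    by_cases hx : ∀ d, d ≠ c → x ≠ sgCorner n d
    · rw [h.ncard_neighborSet_glue _ hx]
      exact ih x
    · push Not at hx
      obtain ⟨d, hdc, rfl⟩ := hx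
      rw [h.ncard_neighborSet_glue_junction _ hdc.symm]
      exact add_le_add (ncard_neighborSet_sgCorner_le n d) (ncard_neighborSet_sgCorner_le n c)

end Gasket

section Limit

open Filter Topology Finset
open scoped BigOperators

lemma sum_card_filter_div_mul_pow_eq_expect {α : Type*} (s : Finset α) {d : α → ℕ} {m : ℕ}
    (hd : ∀ a ∈ s, d a < m) (t : ℝ) :
    ∑ j : Fin m, (#{a ∈ s | d a = j} : ℝ) / #s * t ^ (j : ℕ) = 𝔼 a ∈ s, t ^ d a := by
  rw [expect_eq_sum_div_card, ← sum_fiberwise_of_maps_to fun a ha => mem_range.2 (hd a ha),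
    sum_div, Fin.sum_univ_eq_sum_range fun j => (#{a ∈ s | d a = j} : ℝ) / #s * t ^ j]
  refine sum_congr rfl fun j _ => ?_
  rw [sum_congr rfl fun a ha => congrArg (t ^ ·) (mem_filter.1 ha).2, sum_const, nsmul_eq_mul,
    div_mul_eq_mul_div]

lemma coe_cornerForests_joined {V : Type*} [Finite V] (G : SimpleGraph V) (τ : Fin 3 → V) :
    (cornerForests G τ .joined : Set (SimpleGraph V)) = spanningTrees G := by
  ext T
  rw [mem_coe, mem_cornerForests, isCornerForest_joined_iff]
  rfl

lemma degreeProb_eq (j n : ℕ) (x : sgVertices n) :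
    degreeProb j n x =
      (#{T ∈ cornerForests (SG n) (sgCorner n) .joined | (T.neighborSet x).ncard = j} : ℝ) /
        #(cornerForests (SG n) (sgCorner n) .joined) := by
  classical
  have hdegree (T : SimpleGraph (sgVertices n)) : T.degree x = (T.neighborSet x).ncard := by
    rw [← Nat.card_coe_set_eq, Nat.card_eq_fintype_card, SimpleGraph.card_neighborSet_eq_degree]
  simp only [← Set.ncard_coe_finset, coe_filter, ← mem_coe, coe_cornerForests_joined, ← hdegree]
  rfl

lemma sum_degreeProb_mul_pow (t : ℝ) (n : ℕ) (x : sgVertices n) :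
    ∑ j : Fin 5, degreeProb j n x * t ^ (j : ℕ) =
      𝔼 T ∈ cornerForests (SG n) (sgCorner n) .joined, t ^ (T.neighborSet x).ncard := by
  simp only [degreeProb_eq]
  refine sum_card_filter_div_mul_pow_eq_expect _ (fun T hT => ?_) t
  have hle : T.neighborSet x ⊆ (SG n).neighborSet x := fun _ hadj => (mem_cornerForests.1 hT).1 hadj
  exact Nat.lt_succ_of_le ((Set.ncard_le_ncard hle).trans (ncard_neighborSet_SG_le n x))

lemma sum_averageDegreeProb_mul_pow (t : ℝ) (n : ℕ) :
    ∑ j : Fin 5, averageDegreeProb j n * t ^ (j : ℕ) =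
      (3 * cornerMean t n .joined + interiorMean t n 1) / #(sgVertices n) := by
  have hmeans := hasDegreeMeans_SG t n
  have hcorner (i : Fin 3) : 𝔼 T ∈ cornerForests (SG n) (sgCorner n) .joined,
      t ^ (T.neighborSet (sgCorner n i)).ncard = cornerMean t n .joined := hmeans.corner .joined i
  have hinterior : 𝔼 T ∈ cornerForests (SG n) (sgCorner n) .joined,
      ∑ x ∈ interiorVertices (sgCorner n), t ^ (T.neighborSet x).ncard = interiorMean t n 1 :=
    hmeans.interior .joined
  simp only [averageDegreeProb, div_mul_eq_mul_div, ← sum_div, sum_mul]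
  rw [sum_comm]
  simp only [sum_degreeProb_mul_pow]
  rw [sum_eq_sum_corner_add_sum_interior (isGasketGluing_sgEmbedding n).corner_injective,
    ← hinterior, expect_sum_comm _ (interiorVertices _)]
  simp only [hcorner, sum_const, card_univ, Fintype.card_fin, nsmul_eq_mul, Nat.cast_ofNat]

/-- The limits of `averageDegreeProb j n` for `j < 5`, that is, the coefficients of `limitMean`. -/
noncomputable def degreeLimit : Fin 5 → ℝ :=
  ![0, 10957 / 40464, 6626035 / 13636368, 2943139 / 13636368, 124895 / 4545456]

lemma tendsto_sum_averageDegreeProb_mul_pow (t : ℝ) :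
    Tendsto (fun n => ∑ j : Fin 5, averageDegreeProb j n * t ^ (j : ℕ)) atTop
      (𝓝 (∑ j, degreeLimit j * t ^ (j : ℕ))) := by
  have hlimit : ∑ j, degreeLimit j * t ^ (j : ℕ) =
      (3 * ((11 * t + 3 * t ^ 2) / 14) * 0 + 3 / 2 * limitMean t) / (3 / 2 * (1 + 0)) := by
    simp [degreeLimit, limitMean, Fin.sum_univ_succ]
    ring
  have hpow := tendsto_pow_atTop_nhds_zero_of_lt_one (r := (1 / 3 : ℝ)) (by norm_num) (by norm_num)
  have hnumerator := (((tendsto_cornerMean t .joined).const_mul 3).mul hpow).add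
    (tendsto_interiorMean_div t)
  have hdenominator := (hpow.const_add 1).const_mul (3 / 2 : ℝ)
  rw [hlimit]
  refine (hnumerator.div hdenominator (by norm_num)).congr fun n => ?_
  have hcard : (#(sgVertices n) : ℝ) = 3 / 2 * (1 + (1 / 3) ^ n) * 3 ^ n := by
    have htwo : (2 * #(sgVertices n) : ℝ) = 3 * (3 ^ n + 1) := mod_cast two_mul_card_sgVertices n
    rw [one_div_pow]
    field_simp
    linarith
  rw [sum_averageDegreeProb_mul_pow, hcard, Pi.div_apply, one_div_pow]
  field_simp

end Limit

theorem mainTheorem1 :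
    Filter.Tendsto (fun n : ℕ => averageDegreeProb 1 n) Filter.atTop
        (nhds (10957 / 40464 : ℝ)) ∧
      Filter.Tendsto (fun n : ℕ => averageDegreeProb 2 n) Filter.atTop
        (nhds (6626035 / 13636368 : ℝ)) ∧
      Filter.Tendsto (fun n : ℕ => averageDegreeProb 3 n) Filter.atTop
        (nhds (2943139 / 13636368 : ℝ)) ∧
      Filter.Tendsto (fun n : ℕ => averageDegreeProb 4 n) Filter.atTop
        (nhds (124895 / 4545456 : ℝ)) := by
  have hlimit := tendsto_coeff_of_tendsto_eval tendsto_sum_averageDegreeProb_mul_pow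
  exact ⟨hlimit 1, hlimit 2, hlimit 3, hlimit 4⟩
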